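/- Let $p_1,p_2\ge 1$ be integers and $p:=p_1p_2$. Let $a_{q,r},c_{q,r}\in\mathbb R$ and $\alpha_{q,r},b_{q,r}\in\mathbb C$ $(q,r\in\mathbb Z)$ be $(p_1,p_2)$-periodic, i.e. $w_{q+k_1p_1,\,r+k_2p_2}=w_{q,r}$ for all $q,r,k_1,k_2\in\mathbb Z$. Let $A_q,B_q$ be the bounded operators on $\ell^2(\mathbb Z)$ given by $$(A_qv)_r=\overline{\alpha_{q,r-1}}\,v_{r-1}+a_{q,r}v_r+\alpha_{q,r}v_{r+1},\qquad (B_qv)_r=\overline{b_{q,r-1}}\,v_{r-1}+c_{q,r}v_r+b_{q,r}v_{r+1},$$ and let $J$ be the $(p_1,p_2)$-periodic Jacobi-block-Jacobi operator on $\ell^2(\mathbb Z,\ell^2(\mathbb Z))$, $$(Ju)_q=A_{q-1}u_{q-1}+B_qu_q+A_qu_{q+1},\qquad q\in\mathbb Z.$$ For sequences $d,u,l$ of complex numbers (or of square matrices of one size), $m\ge1$ and $x\in\mathbb R$, let $F_m(d,u,l;x)$ be the $m\times m$ (block) matrix that is the sum of the diagonal matrix with entries $d_1,\dots,d_m$,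 the matrix with $u_1,\dots,u_{m-1}$ on the first superdiagonal, the matrix with $l_1,\dots,l_{m-1}$ on the first subdiagonal, the matrix whose only nonzero entry is $e^{ix}l_m$ at position $(1,m)$, and the matrix whose only nonzero entry is $e^{-ix}u_m$ at position $(m,1)$. (For $m\ge3$ the positions are distinct; for $m\le2$ coinciding entries are added.) Put $$\mathcal A_n(x_2)=F_{p_2}\big((a_{n,r})_r,(\alpha_{n,r})_r,(\overline{\alpha_{n,r}})_r;x_2\big),\qquad \mathcal B_n(x_2)=F_{p_2}\big((c_{n,r})_r,(b_{n,r})_r,(\overline{b_{n,r}})_r;x_2\big),$$ and let the symbol of $J$ be the Hermitian matrix of order $p$ $$\mathcal S(x_1,x_2)=F_{p_1}\big((\mathcal B_n(x_2))_n,(\mathcal A_n(x_2))_n,(\mathcal A_n(x_2))_n;x_1\big).$$ Let $\lambda_1(x_1,x_2)\ge\dots\ge\lambda_p(x_1,x_2)$ be the eigenvalues of $\mathcal S(x_1,x_2)$, repeated according to multiplicity, and let $\mathbb T^2=[0,2\pi)\times[0,2\pi)$. Then each $\lambda_k$ is bounded on $\mathbb T^2$, and the spectrum of $J$ is the union of $p$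 closed bounded intervals (bands), $$\sigma(J)=\bigcup_{k=1}^{p}\Big[\inf_{\mathbb T^2}\lambda_k,\ \sup_{\mathbb T^2}\lambda_k\Big]\subset\mathbb R .$$ Consequently $\sigma(J)$ has at most $p-1$ gaps, where a gap is a nonempty open interval with both endpoints in $\sigma(J)$ that contains no point of $\sigma(J)$. -/

import Mathlib

open scoped ComplexConjugate

noncomputable section

namespace JBJ

/-! ## Tridiagonal (Jacobi) operators on `ℓ²(ℤ, H)` -/

/-- `ℓ²(ℤ, H)`. -/
abbrev SeqSpace (H : Type) [NormedAddCommGroup H] : Type := lp (fun _ : ℤ => H) 2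

theorem summable_shift {H : Type} [NormedAddCommGroup H] (s : ℤ) (u : SeqSpace H) :
    Summable (fun q : ℤ => ‖u (q + s)‖ ^ 2) := by
  have h := (lp.memℓp u).summable (by norm_num)
  have h2 : Summable (fun q : ℤ => ‖u q‖ ^ 2) := by simpa using h
  exact h2.comp_injective (add_left_injective s)

theorem norm_sq_eq {H : Type} [NormedAddCommGroup H] (u : SeqSpace H) : ‖u‖ ^ 2 = ∑' q : ℤ, ‖u q‖ ^ 2 := by
  have h := lp.norm_rpow_eq_tsum (p := 2) (by norm_num) u
  simpa using h

section Tridiagonal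

variable {H : Type} [NormedAddCommGroup H] [NormedSpace ℂ H]

theorem memLp_weightedShift (s : ℤ) (T : ℤ → H →L[ℂ] H) (hT : ∃ C, ∀ q, ‖T q‖ ≤ C)
    (u : SeqSpace H) : Memℓp (fun q : ℤ => T q (u (q + s))) 2 := by
  obtain ⟨C, hC⟩ := hT
  apply memℓp_gen
  have h : Summable (fun q : ℤ => C ^ 2 * ‖u (q + s)‖ ^ 2) := (summable_shift s u).mul_left _
  simp only [ENNReal.toReal_ofNat, Real.rpow_ofNat]
  refine Summable.of_nonneg_of_le (fun q => by positivity) (fun q => ?_) h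
  rw [← mul_pow]
  exact pow_le_pow_left₀ (norm_nonneg _) ((T q).le_of_opNorm_le (hC q) _) 2

/-- The bounded operator `u ↦ (q ↦ T_q u_{q+s})` on `ℓ²(ℤ, H)`, for a bounded sequence `T`. -/
def weightedShift (s : ℤ) (T : ℤ → H →L[ℂ] H) (hT : ∃ C, ∀ q, ‖T q‖ ≤ C) :
    SeqSpace H →L[ℂ] SeqSpace H :=
  LinearMap.mkContinuousOfExistsBound
    { toFun := fun u => ⟨fun q => T q (u (q + s)), memLp_weightedShift s T hT u⟩
      map_add' := fun u v => by ext q : 2; simp; rfl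
      map_smul' := fun c u => by ext q : 2; simp } (by
    have hT' := hT
    obtain ⟨C, hC⟩ := hT
    have hC0 : 0 ≤ C := (norm_nonneg _).trans (hC 0)
    refine ⟨C, fun u => ?_⟩
    refine le_of_sq_le_sq ?_ (by positivity)
    rw [mul_pow, norm_sq_eq, norm_sq_eq u, ← tsum_mul_left,
      ← (Equiv.addRight s).tsum_eq (fun q : ℤ => C ^ 2 * ‖u q‖ ^ 2)]
    refine Summable.tsum_le_tsum (fun q => ?_) ?_ ((summable_shift s u).mul_left _)
    · rw [← mul_pow]
      exact pow_le_pow_left₀ (norm_nonneg _) ((T q).le_of_opNorm_le (hC q) _) 2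
    · simpa using (memLp_weightedShift s T hT' u).summable (by norm_num))

/-- The tridiagonal operator `(Ju)_q = L_q u_{q-1} + D_q u_q + U_q u_{q+1}` on `ℓ²(ℤ, H)`. -/
def tridiagonal (L D U : ℤ → H →L[ℂ] H) (hL : ∃ C, ∀ q, ‖L q‖ ≤ C)
    (hD : ∃ C, ∀ q, ‖D q‖ ≤ C) (hU : ∃ C, ∀ q, ‖U q‖ ≤ C) : SeqSpace H →L[ℂ] SeqSpace H :=
  weightedShift (-1) L hL + weightedShift 0 D hD + weightedShift 1 U hU

theorem tridiagonal_apply (L D U : ℤ → H →L[ℂ] H) (hL : ∃ C, ∀ q, ‖L q‖ ≤ C)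
    (hD : ∃ C, ∀ q, ‖D q‖ ≤ C) (hU : ∃ C, ∀ q, ‖U q‖ ≤ C) (u : SeqSpace H) (q : ℤ) :
    tridiagonal L D U hL hD hU u q = L q (u (q - 1)) + D q (u q) + U q (u (q + 1)) := by
  have h : tridiagonal L D U hL hD hU u q
      = L q (u (q + (-1))) + D q (u (q + 0)) + U q (u (q + 1)) := rfl
  rw [h, add_zero, ← sub_eq_add_neg]

end Tridiagonal

theorem bounded_of_periodic {E : Type} [NormedAddCommGroup E] (p : ℕ) [NeZero p] (f : ℤ → E)
    (hf : ∀ q k : ℤ, f (q + k * p) = f q) : ∃ C, ∀ q, ‖f q‖ ≤ C := by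
  have hp : (0 : ℤ) < p := by exact_mod_cast Nat.pos_of_ne_zero (NeZero.ne p)
  refine ⟨∑ i ∈ Finset.range p, ‖f i‖, fun q => ?_⟩
  have h0 := Int.emod_nonneg q hp.ne'
  have h1 := Int.emod_lt_of_pos q hp
  have h2 : f q = f ((q % p).toNat : ℤ) := by
    rw [Int.toNat_of_nonneg h0, ← hf (q % p) (q / p)]
    congr 1
    rw [mul_comm]
    exact (Int.emod_add_mul_ediv q p).symm
  rw [h2]
  exact Finset.single_le_sum (f := fun i : ℕ => ‖f i‖) (fun _ _ => norm_nonneg _)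
    (Finset.mem_range.2 (by omega))

/-! ## Periodic coefficients and the Jacobi-block-Jacobi operator -/

/-- A double sequence `w` is `(p₁, p₂)`-periodic. -/
def IsPeriodic {E : Type} (p₁ p₂ : ℕ) (w : ℤ → ℤ → E) : Prop :=
  ∀ q r k₁ k₂ : ℤ, w (q + k₁ * p₁) (r + k₂ * p₂) = w q r

/-- `(p₁, p₂)`-periodic coefficients of a Jacobi-block-Jacobi matrix: the block `A_q` has diagonal
`a q` and upper diagonal `α q`; the block `B_q` has diagonal `c q` and upper diagonal `b q`. -/
structure Coeffs (p₁ p₂ : ℕ) where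
  a : ℤ → ℤ → ℝ
  α : ℤ → ℤ → ℂ
  c : ℤ → ℤ → ℝ
  b : ℤ → ℤ → ℂ
  a_periodic : IsPeriodic p₁ p₂ a
  α_periodic : IsPeriodic p₁ p₂ α
  c_periodic : IsPeriodic p₁ p₂ c
  b_periodic : IsPeriodic p₁ p₂ b

/-- Multiplication by the scalar `z`, as an operator on `ℂ`. -/
def scalarOp (z : ℂ) : ℂ →L[ℂ] ℂ := z • ContinuousLinearMap.id ℂ ℂ

/-- The `p`-periodic Hermitian Jacobi operator on `ℓ²(ℤ)`, with real entries `d` on the main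
diagonal, entries `w` above it and their conjugates below it:
`(Kv)_r = conj (w_{r-1}) v_{r-1} + d_r v_r + w_r v_{r+1}`. -/
def jacobi (p : ℕ) [NeZero p] (d : ℤ → ℝ) (w : ℤ → ℂ) (hd : ∀ q k : ℤ, d (q + k * p) = d q)
    (hw : ∀ q k : ℤ, w (q + k * p) = w q) : SeqSpace ℂ →L[ℂ] SeqSpace ℂ :=
  tridiagonal (fun r => scalarOp (conj (w (r - 1)))) (fun r => scalarOp (d r))
    (fun r => scalarOp (w r))
    (bounded_of_periodic p _ fun q k => by rw [add_sub_right_comm, hw])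
    (bounded_of_periodic p _ fun q k => by rw [hd])
    (bounded_of_periodic p _ fun q k => by rw [hw])

theorem jacobi_apply (p : ℕ) [NeZero p] (d : ℤ → ℝ) (w : ℤ → ℂ)
    (hd : ∀ q k : ℤ, d (q + k * p) = d q) (hw : ∀ q k : ℤ, w (q + k * p) = w q)
    (v : SeqSpace ℂ) (r : ℤ) :
    jacobi p d w hd hw v r
      = conj (w (r - 1)) * v (r - 1) + (d r : ℂ) * v r + w r * v (r + 1) := by
  simp [jacobi, tridiagonal_apply, scalarOp]

namespace Coeffs

variable {p₁ p₂ : ℕ} [NeZero p₂]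

/-- The block `A_q`. -/
def A (S : Coeffs p₁ p₂) (q : ℤ) : SeqSpace ℂ →L[ℂ] SeqSpace ℂ :=
  jacobi p₂ (S.a q) (S.α q) (fun r k => by simpa using S.a_periodic q r 0 k)
    (fun r k => by simpa using S.α_periodic q r 0 k)

/-- The block `B_q`. -/
def B (S : Coeffs p₁ p₂) (q : ℤ) : SeqSpace ℂ →L[ℂ] SeqSpace ℂ :=
  jacobi p₂ (S.c q) (S.b q) (fun r k => by simpa using S.c_periodic q r 0 k)
    (fun r k => by simpa using S.b_periodic q r 0 k)

theorem A_periodic (S : Coeffs p₁ p₂) (q k : ℤ) : S.A (q + k * p₁) = S.A q := by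
  have h1 : S.a (q + k * p₁) = S.a q := by
    funext r; simpa using S.a_periodic q r k 0
  have h2 : S.α (q + k * p₁) = S.α q := by
    funext r; simpa using S.α_periodic q r k 0
  simp only [A, h1, h2]

theorem B_periodic (S : Coeffs p₁ p₂) (q k : ℤ) : S.B (q + k * p₁) = S.B q := by
  have h1 : S.c (q + k * p₁) = S.c q := by
    funext r; simpa using S.c_periodic q r k 0
  have h2 : S.b (q + k * p₁) = S.b q := by
    funext r; simpa using S.b_periodic q r k 0
  simp only [B, h1, h2]

/-- The Jacobi-block-Jacobi operator `(Ju)_q = A_{q-1} u_{q-1} + B_q u_q + A_q u_{q+1}` on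
`ℓ²(ℤ, ℓ²(ℤ))`. -/
def J [NeZero p₁] (S : Coeffs p₁ p₂) : SeqSpace (SeqSpace ℂ) →L[ℂ] SeqSpace (SeqSpace ℂ) :=
  tridiagonal (fun q => S.A (q - 1)) S.B S.A
    (bounded_of_periodic p₁ _ fun q k => by rw [add_sub_right_comm, S.A_periodic])
    (bounded_of_periodic p₁ _ S.B_periodic)
    (bounded_of_periodic p₁ _ S.A_periodic)

theorem J_apply [NeZero p₁] (S : Coeffs p₁ p₂) (u : SeqSpace (SeqSpace ℂ)) (q : ℤ) :
    S.J u q = S.A (q - 1) (u (q - 1)) + S.B q (u q) + S.A q (u (q + 1)) :=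
  tridiagonal_apply _ _ _ _ _ _ u q

end Coeffs

/-! ## The symbol -/

/-- The `p × p` matrix (rows and columns numbered `1, …, p`; the element `i` of `Fin p` stands for
the number `i + 1`) which is the sum of
* the diagonal with entries `d_1, …, d_p`,
* the upper diagonal with entries `u_1, …, u_{p-1}` and the lower one with `l_1, …, l_{p-1}`,
* the corner entries `e^{ix} l_p` at `(1, p)` and `e^{-ix} u_p` at `(p, 1)`.

For `p ≥ 3` these positions are all different; for `p ≤ 2` coinciding entries are added up. -/
def floquet {R : Type} [AddCommMonoid R] [Module ℂ R] (p : ℕ) (d u l : ℤ → R) (x : ℝ) :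
    Matrix (Fin p) (Fin p) R :=
  Matrix.of fun i k =>
    (if i = k then d ((i : ℕ) + 1) else 0)
    + (if (k : ℕ) = (i : ℕ) + 1 then u ((i : ℕ) + 1) else 0)
    + (if (i : ℕ) = (k : ℕ) + 1 then l ((k : ℕ) + 1) else 0)
    + (if (i : ℕ) = 0 ∧ (k : ℕ) + 1 = p then Complex.exp (Complex.I * x) • l p else 0)
    + (if (i : ℕ) + 1 = p ∧ (k : ℕ) = 0 then Complex.exp (-(Complex.I * x)) • u p else 0)

/-- The torus `[0, 2π) × [0, 2π)`. -/
def torus : Set (ℝ × ℝ) := Set.Ico 0 (2 * Real.pi) ×ˢ Set.Ico 0 (2 * Real.pi)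

theorem conj_exp_I (x : ℝ) :
    conj (Complex.exp (Complex.I * x)) = Complex.exp (-(Complex.I * x)) := by
  rw [← Complex.exp_conj]; simp

theorem conj_exp_neg_I (x : ℝ) :
    conj (Complex.exp (-(Complex.I * x))) = Complex.exp (Complex.I * x) := by
  rw [← Complex.exp_conj]; simp

theorem floquet_star {R : Type} [AddCommMonoid R] [Module ℂ R] [StarAddMonoid R]
    [StarModule ℂ R] (p : ℕ) (d u l : ℤ → R) (x : ℝ) (hd : ∀ q, star (d q) = d q)
    (hu : ∀ q, star (u q) = l q) (i k : Fin p) :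
    star (floquet p d u l x i k) = floquet p d u l x k i := by
  have hl : ∀ q, star (l q) = u q := fun q => by rw [← hu, star_star]
  simp only [floquet, Matrix.of_apply, star_add, apply_ite star, star_zero, hd, hu, hl, star_smul,
    ← starRingEnd_apply, conj_exp_I, conj_exp_neg_I]
  have e1 : (if i = k then d ((i : ℕ) + 1) else 0) = if k = i then d ((k : ℕ) + 1) else 0 := by
    by_cases h : i = k
    · subst h; rfl
    · rw [if_neg h, if_neg (Ne.symm h)]
  simp only [e1, and_comm (a := (i : ℕ) = 0), and_comm (a := (i : ℕ) + 1 = p)]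
  abel

namespace Coeffs

variable {p₁ p₂ : ℕ}

/-- The matrix `𝒜_n(x₂)` of order `p₂`. -/
def symbA (S : Coeffs p₁ p₂) (n : ℤ) (x₂ : ℝ) : Matrix (Fin p₂) (Fin p₂) ℂ :=
  floquet p₂ (fun r => (S.a n r : ℂ)) (S.α n) (fun r => conj (S.α n r)) x₂

/-- The matrix `ℬ_n(x₂)` of order `p₂`. -/
def symbB (S : Coeffs p₁ p₂) (n : ℤ) (x₂ : ℝ) : Matrix (Fin p₂) (Fin p₂) ℂ :=
  floquet p₂ (fun r => (S.c n r : ℂ)) (S.b n) (fun r => conj (S.b n r)) x₂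

/-- The symbol `𝒮(x₁, x₂)`: the block matrix with blocks `ℬ_n` on the diagonal, `𝒜_n` next to it,
and the corner blocks `e^{ix₁} 𝒜_{p₁}` and `e^{-ix₁} 𝒜_{p₁}`. -/
def symbol (S : Coeffs p₁ p₂) (x : ℝ × ℝ) : Matrix (Fin p₁ × Fin p₂) (Fin p₁ × Fin p₂) ℂ :=
  Matrix.comp (Fin p₁) (Fin p₁) (Fin p₂) (Fin p₂) ℂ
    (floquet p₁ (fun n => S.symbB n x.2) (fun n => S.symbA n x.2) (fun n => S.symbA n x.2) x.1)

theorem symbA_star (S : Coeffs p₁ p₂) (n : ℤ) (x₂ : ℝ) : star (S.symbA n x₂) = S.symbA n x₂ := by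
  ext i k
  rw [Matrix.star_apply]
  exact floquet_star _ _ _ _ _ (fun _ => Complex.conj_ofReal _) (fun _ => rfl) k i

theorem symbB_star (S : Coeffs p₁ p₂) (n : ℤ) (x₂ : ℝ) : star (S.symbB n x₂) = S.symbB n x₂ := by
  ext i k
  rw [Matrix.star_apply]
  exact floquet_star _ _ _ _ _ (fun _ => Complex.conj_ofReal _) (fun _ => rfl) k i

theorem symbol_isHermitian (S : Coeffs p₁ p₂) (x : ℝ × ℝ) : (S.symbol x).IsHermitian := by
  ext ⟨i, j⟩ ⟨k, l⟩
  have h := floquet_star p₁ (fun n => S.symbB n x.2) (fun n => S.symbA n x.2)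
    (fun n => S.symbA n x.2) x.1 (fun n => S.symbB_star n x.2) (fun n => S.symbA_star n x.2) k i
  have h2 := congrFun (congrFun h j) l
  rw [Matrix.star_apply] at h2
  exact h2

/-- The `k`-th eigenvalue `λ_k(x₁, x₂)` of the symbol, `k = 1, …, p₁p₂` (here numbered from `0`),
with eigenvalues repeated according to multiplicity and in non-increasing order
(`Matrix.IsHermitian.eigenvalues₀` is non-increasing). -/
def eigenvalue (S : Coeffs p₁ p₂) (k : Fin (p₁ * p₂)) (x : ℝ × ℝ) : ℝ :=
  (S.symbol_isHermitian x).eigenvalues₀ (Fin.cast (by simp) k)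

/-- The `k`-th band `[inf λ_k, sup λ_k]`, the infimum and the supremum being over the torus. -/
def band (S : Coeffs p₁ p₂) (k : Fin (p₁ * p₂)) : Set ℝ :=
  Set.Icc (sInf (S.eigenvalue k '' torus)) (sSup (S.eigenvalue k '' torus))

end Coeffs

/-- The gaps of a closed set `σ ⊆ ℝ`: the nonempty open intervals with both endpoints in `σ` and
without points of `σ`, that is, the bounded connected components of the complement of `σ`. -/
def gaps (σ : Set ℝ) : Set (Set ℝ) :=
  {G | ∃ l r : ℝ, l < r ∧ l ∈ σ ∧ r ∈ σ ∧ G = Set.Ioo l r ∧ Disjoint G σ}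

end JBJ

end

/-! This is Floquet–Bloch theory without direct integrals. The operator commutes with translations
by the periods, and on sequences that pick up the phases `e^{-ix₁}`, `e^{-ix₂}` under these
translations it acts on the values in one cell as the symbol at `x` (`symbol_mulVec`).

By Weyl's inequality the ordered eigenvalues of the symbol are continuous in `x`. They are
2π-periodic, so each image of the torus is compact and connected, hence equal to its band
(`band_eq_image`). The union of the bands is therefore closed and consists exactly of the
eigenvalues of all symbols.

Bands lie in the spectrum (`eigenvalue_mem_spectrum`): an eigenvector of the symbol extends to a
bounded generalized eigenfunction. Cut off to `N × N` cells, it has squared norm at least of order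
`N²`, while the squared error, supported near the boundary of the box, is `O(N)`. So `J - t` is not
bounded below.

Conversely (`bounded_below_J_sub_smul`), if `t` has distance at least `δ` from all symbol
eigenvalues, every symbol minus `t` is bounded below by `δ`. A discrete Plancherel identity, exact
on fine grids for finitely supported vectors, transfers this bound to `J - t`. Density and
self-adjointness then put `t` in the resolvent set.

For the gaps, the right endpoint of a gap is the left endpoint of a band, never the smallest one,
and it determines the gap (`encard_gaps_iUnion_Icc_le`). -/

noncomputable section

namespace JBJ

/-! ### Quadratic forms and ordered eigenvalues of symmetric operators -/

section Spectral

open scoped InnerProductSpace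

variable {E : Type*} [NormedAddCommGroup E] [InnerProductSpace ℂ E] [FiniteDimensional ℂ E]
  {n : ℕ}

theorem re_inner_apply_self_eq_sum {T : E →ₗ[ℂ] E} (hT : T.IsSymmetric)
    (hn : Module.finrank ℂ E = n) (v : E) :
    (⟪v, T v⟫_ℂ).re
      = ∑ j, hT.eigenvalues hn j * ‖⟪hT.eigenvectorBasis hn j, v⟫_ℂ‖ ^ 2 := by
  rw [← (hT.eigenvectorBasis hn).sum_inner_mul_inner v (T v), Complex.re_sum]
  refine Finset.sum_congr rfl fun j _ => ?_
  rw [← hT, hT.apply_eigenvectorBasis, inner_smul_left, ← inner_conj_symm v,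
    mul_left_comm]
  rw [← Complex.normSq_eq_conj_mul_self, Complex.normSq_eq_norm_sq]
  simp [-Complex.ofReal_pow]

theorem norm_sq_apply_sub_smul_eq_sum {T : E →ₗ[ℂ] E} (hT : T.IsSymmetric)
    (hn : Module.finrank ℂ E = n) (μ : ℝ) (v : E) :
    ‖T v - (μ : ℂ) • v‖ ^ 2
      = ∑ j, (hT.eigenvalues hn j - μ) ^ 2 * ‖⟪hT.eigenvectorBasis hn j, v⟫_ℂ‖ ^ 2 := by
  rw [← (hT.eigenvectorBasis hn).sum_sq_norm_inner_right]
  refine Finset.sum_congr rfl fun j _ => ?_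
  rw [inner_sub_right, ← hT, hT.apply_eigenvectorBasis, inner_smul_left, inner_smul_right,
    ← sub_mul, norm_mul, mul_pow]
  congr 1
  change ‖conj ((hT.eigenvalues hn j : ℝ) : ℂ) - (μ : ℂ)‖ ^ 2 = _
  rw [Complex.conj_ofReal, ← Complex.ofReal_sub, Complex.norm_real, Real.norm_eq_abs, sq_abs]

theorem le_norm_apply_sub_smul {T : E →ₗ[ℂ] E} (hT : T.IsSymmetric)
    (hn : Module.finrank ℂ E = n) (μ δ : ℝ) (hδ : 0 ≤ δ)
    (h : ∀ j, δ ≤ |hT.eigenvalues hn j - μ|) (v : E) :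
    δ ^ 2 * ‖v‖ ^ 2 ≤ ‖T v - (μ : ℂ) • v‖ ^ 2 := by
  rw [norm_sq_apply_sub_smul_eq_sum hT hn, ← (hT.eigenvectorBasis hn).sum_sq_norm_inner_right,
    Finset.mul_sum]
  refine Finset.sum_le_sum fun j _ => ?_
  rw [← sq_abs (_ - μ)]
  gcongr
  exact h j

/-- Weyl's monotonicity: a bound between quadratic forms carries over to ordered eigenvalues. -/
theorem eigenvalues_le_eigenvalues_add {T S : E →ₗ[ℂ] E} (hT : T.IsSymmetric)
    (hS : S.IsSymmetric) (hn : Module.finrank ℂ E = n) (ε : ℝ)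
    (h : ∀ v, (⟪v, T v⟫_ℂ).re ≤ (⟪v, S v⟫_ℂ).re + ε * ‖v‖ ^ 2) (i : Fin n) :
    hT.eigenvalues hn i ≤ hS.eigenvalues hn i + ε := by
  classical
  set b := hT.eigenvectorBasis hn
  set c := hS.eigenvectorBasis hn
  -- These are only `n - 1` linear conditions, so some `v ≠ 0` satisfies them all. It is orthogonal
  -- to `c j` for `j < i` and to `b j` for `j > i`, which bounds the form of `S` above and that of
  -- `T` below by the respective `i`-th eigenvalue.
  let f : E →ₗ[ℂ] ({j : Fin n // j ≠ i} → ℂ) := LinearMap.pi fun j =>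
    if (j : Fin n) < i then (innerSL ℂ (c j)).toLinearMap else (innerSL ℂ (b j)).toLinearMap
  have hpos : 0 < n := i.pos
  have hker : LinearMap.ker f ≠ ⊥ := by
    apply LinearMap.ker_ne_bot_of_finrank_lt
    rw [hn, Module.finrank_fintype_fun_eq_card]
    simp
    omega
  obtain ⟨v, hv, hv0⟩ := Submodule.exists_mem_ne_zero_of_ne_bot hker
  have hv' : ∀ j, j ≠ i → (if j < i then ⟪c j, v⟫_ℂ else ⟪b j, v⟫_ℂ) = 0 := by
    intro j hj
    have := congrFun (LinearMap.mem_ker.1 hv) ⟨j, hj⟩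
    simp only [f, LinearMap.pi_apply] at this
    split_ifs at this ⊢ with hji <;> simpa using this
  have h1 : hT.eigenvalues hn i * ‖v‖ ^ 2 ≤ (⟪v, T v⟫_ℂ).re := by
    rw [re_inner_apply_self_eq_sum hT hn, ← b.sum_sq_norm_inner_right, Finset.mul_sum]
    refine Finset.sum_le_sum fun j _ => ?_
    rcases le_or_gt j i with hji | hji
    · exact mul_le_mul_of_nonneg_right (hT.eigenvalues_antitone hn hji) (by positivity)
    · have := hv' j hji.ne'
      rw [if_neg hji.not_gt] at this
      simp [b, this] at this ⊢
  have h2 : (⟪v, S v⟫_ℂ).re ≤ hS.eigenvalues hn i * ‖v‖ ^ 2 := by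
    rw [re_inner_apply_self_eq_sum hS hn, ← c.sum_sq_norm_inner_right, Finset.mul_sum]
    refine Finset.sum_le_sum fun j _ => ?_
    rcases le_or_gt i j with hji | hji
    · exact mul_le_mul_of_nonneg_right (hS.eigenvalues_antitone hn hji) (by positivity)
    · have := hv' j hji.ne
      rw [if_pos hji] at this
      simp [c, this] at this ⊢
  have h3 : 0 < ‖v‖ ^ 2 := by positivity
  have h4 := h v
  by_contra hcon
  nlinarith

end Spectral

/-! ### Continuity of ordered eigenvalues -/

section Matrix

variable {ι : Type*} [Fintype ι] [DecidableEq ι]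

theorem eigenvalues₀_le_add_norm {A B : Matrix ι ι ℂ} (hA : A.IsHermitian)
    (hB : B.IsHermitian) (k : Fin (Fintype.card ι)) :
    hA.eigenvalues₀ k ≤ hB.eigenvalues₀ k
      + ‖Matrix.toEuclideanCLM (𝕜 := ℂ) (n := ι) (A - B)‖ := by
  refine eigenvalues_le_eigenvalues_add _ _ _ _ (fun v => ?_) k
  have h1 : Matrix.toEuclideanLin A v
      = Matrix.toEuclideanLin B v + Matrix.toEuclideanCLM (𝕜 := ℂ) (n := ι) (A - B) v := by
    rw [map_sub]
    change _ = _ + (Matrix.toEuclideanLin A v - Matrix.toEuclideanLin B v)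
    abel
  rw [h1, inner_add_right, Complex.add_re]
  gcongr
  refine (Complex.re_le_norm _).trans ((norm_inner_le_norm _ _).trans ?_)
  rw [sq, mul_left_comm]
  gcongr
  exact ContinuousLinearMap.le_opNorm _ _

/-- Weyl's bound used in both directions makes each ordered eigenvalue 1-Lipschitz in the operator
norm, whatever the multiplicities. -/
theorem continuous_eigenvalues₀ {X : Type*} [TopologicalSpace X] (A : X → Matrix ι ι ℂ)
    (hA : ∀ x, (A x).IsHermitian) (hc : Continuous A) (k : Fin (Fintype.card ι)) :
    Continuous fun x => (hA x).eigenvalues₀ k := by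
  rw [continuous_iff_continuousAt]
  intro x
  rw [ContinuousAt, tendsto_iff_dist_tendsto_zero]
  have hφ : Continuous fun M : Matrix ι ι ℂ => Matrix.toEuclideanCLM (𝕜 := ℂ) (n := ι) M :=
    (Matrix.toEuclideanCLM (𝕜 := ℂ) (n := ι)).toAlgEquiv.toLinearMap.continuous_of_finiteDimensional
  have hlim : Filter.Tendsto
      (fun y => ‖Matrix.toEuclideanCLM (𝕜 := ℂ) (n := ι) (A y - A x)‖) (nhds x) (nhds 0) := by
    have h : Continuous fun y => ‖Matrix.toEuclideanCLM (𝕜 := ℂ) (n := ι) (A y - A x)‖ :=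
      (hφ.comp (hc.sub continuous_const)).norm
    simpa using h.tendsto x
  refine squeeze_zero (fun _ => dist_nonneg) (fun y => ?_) hlim
  rw [Real.dist_eq, abs_le]
  have h1 := eigenvalues₀_le_add_norm (hA y) (hA x) k
  have h2 := eigenvalues₀_le_add_norm (hA x) (hA y) k
  rw [← neg_sub, map_neg, norm_neg] at h2
  constructor <;> linarith

end Matrix

/-! ### Counting gaps of a finite union of intervals -/

section Gaps

variable {ι : Type*} [Finite ι]

/-- A finite union of nonempty compact intervals has fewer gaps than there are intervals. -/
theorem encard_gaps_iUnion_Icc_le [Nonempty ι] (m M : ι → ℝ) :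
    (gaps (⋃ k, Set.Icc (m k) (M k))).encard ≤ ((Nat.card ι - 1 : ℕ) : ℕ∞) := by
  obtain ⟨k₀, hk₀⟩ := Finite.exists_min m
  have hright : ∀ G ∈ gaps (⋃ k, Set.Icc (m k) (M k)), ∃ k, k ≠ k₀ ∧
      m k ∈ ⋃ k, Set.Icc (m k) (M k) ∧ ∃ l < m k, l ∈ (⋃ k, Set.Icc (m k) (M k)) ∧
        G = Set.Ioo l (m k) ∧ Disjoint G (⋃ k, Set.Icc (m k) (M k)) := by
    rintro G ⟨l, r, hlr, hl, hr, rfl, hdisj⟩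
    obtain ⟨k, hk⟩ := Set.mem_iUnion.1 hr
    -- If `m k < r`, points of the same interval just to the left of `r` would lie in the gap.
    have hkr : m k = r := by
      by_contra hne
      have hlt : m k < r := lt_of_le_of_ne hk.1 hne
      obtain ⟨y, hy1, hy2⟩ := exists_between (max_lt hlr hlt)
      rw [max_lt_iff] at hy1
      exact Set.disjoint_left.1 hdisj ⟨hy1.1, hy2⟩
        (Set.mem_iUnion.2 ⟨k, hy1.2.le, hy2.le.trans hk.2⟩)
    obtain ⟨k', hk'⟩ := Set.mem_iUnion.1 hl
    subst hkr
    refine ⟨k, ?_, hr, l, hlr, hl, rfl, hdisj⟩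
    -- The left endpoint `l` of the gap lies in some interval, so `m k' ≤ l < m k`; hence `m k` is
    -- not minimal.
    rintro rfl
    exact absurd (hk₀ k') (by linarith [hk'.1])
  choose! f hf0 hfm hf using hright
  -- Of two different gaps with a common right endpoint, the longer would contain the left endpoint
  -- of the shorter, a point of the union.
  have hinj : Set.InjOn f (gaps (⋃ k, Set.Icc (m k) (M k))) := by
    intro G hG G' hG' he
    obtain ⟨l, hl, hlm, hGe, hd⟩ := hf G hG
    obtain ⟨l', hl', hlm', hGe', hd'⟩ := hf G' hG'
    rw [← he] at hl' hGe'
    rcases lt_trichotomy l l' with h | h | h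
    · exact absurd hlm' (Set.disjoint_left.1 hd (by rw [hGe]; exact ⟨h, hl'⟩))
    · rw [hGe, hGe', h]
    · exact absurd hlm (Set.disjoint_left.1 hd' (by rw [hGe']; exact ⟨h, hl⟩))
  have hmaps : Set.MapsTo f (gaps (⋃ k, Set.Icc (m k) (M k))) {k₀}ᶜ := fun G hG => hf0 G hG
  refine (Set.encard_le_encard_of_injOn hmaps hinj).trans ?_
  rw [← Set.Finite.cast_ncard_eq (Set.toFinite _), Set.ncard_compl, Set.ncard_singleton]

end Gaps

/-! ### Bands as images of the torus -/

namespace Coeffs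

variable {p₁ p₂ : ℕ} (S : Coeffs p₁ p₂)

theorem continuous_floquet {R X : Type} [AddCommMonoid R] [Module ℂ R] [TopologicalSpace R]
    [ContinuousAdd R] [ContinuousSMul ℂ R] [TopologicalSpace X] (p : ℕ) {d u l : X → ℤ → R}
    {x : X → ℝ} (hd : ∀ n, Continuous fun y => d y n) (hu : ∀ n, Continuous fun y => u y n)
    (hl : ∀ n, Continuous fun y => l y n) (hx : Continuous x) :
    Continuous fun y => floquet p (d y) (u y) (l y) (x y) := by
  refine continuous_matrix fun i k => ?_
  have h0 : Continuous fun _ : X => (0 : R) := continuous_const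
  simp only [floquet, Matrix.of_apply]
  refine Continuous.add (Continuous.add (Continuous.add (Continuous.add ?_ ?_) ?_) ?_) ?_
  · split_ifs; exacts [hd _, h0]
  · split_ifs; exacts [hu _, h0]
  · split_ifs; exacts [hl _, h0]
  · split_ifs
    · exact Continuous.smul (by fun_prop) (hl _)
    · exact h0
  · split_ifs
    · exact Continuous.smul (by fun_prop) (hu _)
    · exact h0

theorem continuous_symbol : Continuous S.symbol := by
  have hA : ∀ n, Continuous fun x : ℝ × ℝ => S.symbA n x.2 := fun n =>
    continuous_floquet p₂ (fun _ => continuous_const) (fun _ => continuous_const)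
      (fun _ => continuous_const) continuous_snd
  have hB : ∀ n, Continuous fun x : ℝ × ℝ => S.symbB n x.2 := fun n =>
    continuous_floquet p₂ (fun _ => continuous_const) (fun _ => continuous_const)
      (fun _ => continuous_const) continuous_snd
  have h := continuous_floquet p₁ hB hA hA continuous_fst
  refine continuous_matrix fun i k => ?_
  exact (h.matrix_elem i.1 k.1).matrix_elem i.2 k.2

theorem continuous_eigenvalue (k : Fin (p₁ * p₂)) : Continuous (S.eigenvalue k) :=
  continuous_eigenvalues₀ S.symbol S.symbol_isHermitian S.continuous_symbol _

theorem eigenvalue_congr {x y : ℝ × ℝ} (h : S.symbol x = S.symbol y) (k : Fin (p₁ * p₂)) :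
    S.eigenvalue k x = S.eigenvalue k y := by
  simp only [eigenvalue, h]

theorem floquet_congr {R : Type} [AddCommMonoid R] [Module ℂ R] (p : ℕ) (d u l : ℤ → R)
    {x y : ℝ} (h : Complex.exp (Complex.I * x) = Complex.exp (Complex.I * y)) :
    floquet p d u l x = floquet p d u l y := by
  simp only [floquet, Complex.exp_neg, h]

theorem symbol_congr {x y : ℝ × ℝ}
    (h₁ : Complex.exp (Complex.I * x.1) = Complex.exp (Complex.I * y.1))
    (h₂ : Complex.exp (Complex.I * x.2) = Complex.exp (Complex.I * y.2)) :
    S.symbol x = S.symbol y := by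
  simp only [symbol, symbA, symbB, floquet_congr _ _ _ _ h₁, floquet_congr _ _ _ _ h₂]

theorem exists_mem_Ico_exp_eq (t : ℝ) : ∃ s ∈ Set.Ico 0 (2 * Real.pi),
    Complex.exp (Complex.I * t) = Complex.exp (Complex.I * s) := by
  refine ⟨toIcoMod Real.two_pi_pos 0 t, by simpa using toIcoMod_mem_Ico Real.two_pi_pos 0 t, ?_⟩
  rw [Complex.exp_eq_exp_iff_exists_int]
  refine ⟨toIcoDiv Real.two_pi_pos 0 t, ?_⟩
  have h := toIcoMod_add_toIcoDiv_zsmul Real.two_pi_pos 0 t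
  conv_lhs => rw [← h]
  push_cast [zsmul_eq_mul]
  ring

theorem exists_mem_torus_symbol_eq (x : ℝ × ℝ) : ∃ y ∈ torus, S.symbol x = S.symbol y := by
  obtain ⟨s, hs, hs'⟩ := exists_mem_Ico_exp_eq x.1
  obtain ⟨t, ht, ht'⟩ := exists_mem_Ico_exp_eq x.2
  exact ⟨(s, t), ⟨hs, ht⟩, S.symbol_congr hs' ht'⟩

/-- The symbol depends on `x` only through `e^{ix₁}` and `e^{ix₂}`. Passing to the closed square
gives compactness, which the half-open torus lacks. -/
theorem image_torus_eq (k : Fin (p₁ * p₂)) :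
    S.eigenvalue k '' torus
      = S.eigenvalue k '' (Set.Icc 0 (2 * Real.pi) ×ˢ Set.Icc 0 (2 * Real.pi)) := by
  refine Set.Subset.antisymm
    (Set.image_mono (Set.prod_mono Set.Ico_subset_Icc_self Set.Ico_subset_Icc_self)) ?_
  rintro _ ⟨x, -, rfl⟩
  obtain ⟨y, hy, h⟩ := S.exists_mem_torus_symbol_eq x
  exact ⟨y, hy, (S.eigenvalue_congr h k).symm⟩

theorem isCompact_image_torus (k : Fin (p₁ * p₂)) : IsCompact (S.eigenvalue k '' torus) := by
  rw [image_torus_eq]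
  exact (isCompact_Icc.prod isCompact_Icc).image (S.continuous_eigenvalue k)

theorem image_torus_nonempty (k : Fin (p₁ * p₂)) : (S.eigenvalue k '' torus).Nonempty :=
  ⟨_, (0, 0), ⟨⟨le_rfl, Real.two_pi_pos⟩, ⟨le_rfl, Real.two_pi_pos⟩⟩, rfl⟩

theorem band_eq_image (k : Fin (p₁ * p₂)) : S.band k = S.eigenvalue k '' torus := by
  refine (eq_Icc_of_connected_compact ⟨S.image_torus_nonempty k, ?_⟩
    (S.isCompact_image_torus k)).symm
  exact (isPreconnected_Ico.prod isPreconnected_Ico).image _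
    (S.continuous_eigenvalue k).continuousOn

theorem iUnion_band_eq : ⋃ k, S.band k = {t | ∃ k x, S.eigenvalue k x = t} := by
  ext t
  simp only [Set.mem_iUnion, band_eq_image, Set.mem_image, Set.mem_ofPred_eq]
  refine exists_congr fun k => ⟨fun ⟨x, _, h⟩ => ⟨x, h⟩, fun ⟨x, h⟩ => ?_⟩
  obtain ⟨y, hy, h'⟩ := S.exists_mem_torus_symbol_eq x
  exact ⟨y, hy, by rw [← h, S.eigenvalue_congr h']⟩

theorem isClosed_iUnion_band : IsClosed (⋃ k, S.band k) :=
  isClosed_iUnion_of_finite fun _ => isClosed_Icc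

theorem encard_gaps_iUnion_band_le [NeZero p₁] [NeZero p₂] :
    (gaps (⋃ k, S.band k)).encard ≤ ((p₁ * p₂ - 1 : ℕ) : ℕ∞) := by
  have : Nonempty (Fin (p₁ * p₂)) :=
    ⟨0, Nat.pos_of_ne_zero (mul_ne_zero (NeZero.ne _) (NeZero.ne _))⟩
  simpa [band] using encard_gaps_iUnion_Icc_le
    (fun k => sInf (S.eigenvalue k '' torus)) (fun k => sSup (S.eigenvalue k '' torus))

end Coeffs

/-! ### Symmetric operators and their spectra -/

open scoped InnerProductSpace

section Hilbert

variable {H : Type} [NormedAddCommGroup H] [InnerProductSpace ℂ H]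

/-- Reindexing the inner product by `s` turns the shift around; this is why `T q` is paired with `T'
(q + s)`. -/
theorem inner_weightedShift [CompleteSpace H] (s : ℤ) (T T' : ℤ → H →L[ℂ] H)
    (hT : ∃ C, ∀ q, ‖T q‖ ≤ C) (hT' : ∃ C, ∀ q, ‖T' q‖ ≤ C)
    (h : ∀ q x y, ⟪T q x, y⟫_ℂ = ⟪x, T' (q + s) y⟫_ℂ) (u v : SeqSpace H) :
    ⟪weightedShift s T hT u, v⟫_ℂ = ⟪u, weightedShift (-s) T' hT' v⟫_ℂ := by
  rw [lp.inner_eq_tsum, lp.inner_eq_tsum,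
    ← (Equiv.addRight s).tsum_eq fun q => ⟪u q, weightedShift (-s) T' hT' v q⟫_ℂ]
  refine tsum_congr fun q => ?_
  change ⟪T q (u (q + s)), v q⟫_ℂ = ⟪u (q + s), T' (q + s) (v (q + s + -s))⟫_ℂ
  rw [h, add_neg_cancel_right]

theorem inner_tridiagonal [CompleteSpace H] (L D U : ℤ → H →L[ℂ] H) (hL : ∃ C, ∀ q, ‖L q‖ ≤ C)
    (hD : ∃ C, ∀ q, ‖D q‖ ≤ C) (hU : ∃ C, ∀ q, ‖U q‖ ≤ C)
    (h : ∀ q x y, ⟪D q x, y⟫_ℂ = ⟪x, D q y⟫_ℂ)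
    (h' : ∀ q x y, ⟪U q x, y⟫_ℂ = ⟪x, L (q + 1) y⟫_ℂ) (u v : SeqSpace H) :
    ⟪tridiagonal L D U hL hD hU u, v⟫_ℂ = ⟪u, tridiagonal L D U hL hD hU v⟫_ℂ := by
  have h1 := inner_weightedShift 1 U L hU hL h' u v
  have h2 := inner_weightedShift 0 D D hD hD (by simpa using h) u v
  have h3 := inner_weightedShift (-1) L U hL hU (fun q x y => by
    rw [← inner_conj_symm, ← sub_eq_add_neg, ← inner_conj_symm x, h', sub_add_cancel]) u v
  rw [neg_neg] at h3
  rw [neg_zero] at h2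
  simp only [tridiagonal, add_apply, inner_add_left, inner_add_right, h1, h2,
    h3]
  ring

/-- A self-adjoint operator with `T - t` bounded below, `t` real, has `t` in its resolvent set. -/
theorem notMem_spectrum_of_bounded_below [CompleteSpace H] (T : H →L[ℂ] H)
    (hT : ∀ u v, ⟪T u, v⟫_ℂ = ⟪u, T v⟫_ℂ) (t c : ℝ) (hc : 0 < c)
    (h : ∀ u, c * ‖u‖ ≤ ‖T u - (t : ℂ) • u‖) : (t : ℂ) ∉ spectrum ℂ T := by
  set f : H →L[ℂ] H := algebraMap ℂ (H →L[ℂ] H) t - T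
  have hf : ∀ u, f u = -(T u - (t : ℂ) • u) := fun u => by
    rw [neg_sub]; rfl
  rw [spectrum.notMem_iff, ContinuousLinearMap.isUnit_iff_bijective,
    ContinuousLinearMap.bijective_iff_dense_range_and_antilipschitz]
  refine ⟨?_, c.toNNReal⁻¹, f.antilipschitz_of_bound fun u => ?_⟩
  · rw [Submodule.topologicalClosure_eq_top_iff, Submodule.eq_bot_iff]
    intro u hu
    -- Since `t` is real, `f` is symmetric, so a vector orthogonal to its range lies in its kernel,
    -- which the lower bound makes trivial.
    have h1 : ∀ w, ⟪w, f u⟫_ℂ = 0 := fun w => by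
      rw [← hu (f w) ⟨w, rfl⟩, hf, hf, inner_neg_left, inner_neg_right, inner_sub_left,
        inner_sub_right, hT, inner_smul_left, inner_smul_right, Complex.conj_ofReal]
    have h2 : f u = 0 := inner_self_eq_zero.1 (h1 (f u))
    have h3 := h u
    rw [hf, neg_eq_zero] at h2
    rw [h2, norm_zero] at h3
    exact norm_le_zero_iff.1 (nonpos_of_mul_nonpos_right h3 hc)
  · rw [NNReal.coe_inv, Real.coe_toNNReal _ hc.le, hf, norm_neg, ← div_eq_inv_mul, le_div_iff₀' hc]
    exact h u

theorem im_eq_zero_of_mem_spectrum [CompleteSpace H] (T : H →L[ℂ] H)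
    (hT : ∀ u v, ⟪T u, v⟫_ℂ = ⟪u, T v⟫_ℂ) {z : ℂ} (hz : z ∈ spectrum ℂ T) : z = z.re :=
  IsSelfAdjoint.mem_spectrum_eq_re
    (ContinuousLinearMap.isSelfAdjoint_iff_isSymmetric.2 hT) hz

theorem bounded_below_of_notMem_spectrum (T : H →L[ℂ] H) (t : ℂ) (h : t ∉ spectrum ℂ T) :
    ∃ c > 0, ∀ u, c * ‖u‖ ≤ ‖T u - t • u‖ := by
  rw [spectrum.notMem_iff] at h
  obtain ⟨a, ha⟩ := h
  -- The added `1` keeps the constant positive even if the inverse has norm zero, as on the trivial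
  -- space.
  refine ⟨(‖(↑a⁻¹ : H →L[ℂ] H)‖ + 1)⁻¹, by positivity, fun u => ?_⟩
  rw [inv_mul_le_iff₀ (by positivity)]
  have h1 : (↑a⁻¹ : H →L[ℂ] H) (t • u - T u) = u := by
    have h2 : ((↑a⁻¹ : H →L[ℂ] H) * ↑a) u = u := by rw [Units.inv_mul]; rfl
    rw [ha] at h2
    exact h2
  calc ‖u‖ = ‖(↑a⁻¹ : H →L[ℂ] H) (t • u - T u)‖ := by rw [h1]
    _ ≤ ‖(↑a⁻¹ : H →L[ℂ] H)‖ * ‖t • u - T u‖ := ContinuousLinearMap.le_opNorm _ _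
    _ ≤ _ := by rw [norm_sub_rev]; gcongr; linarith

end Hilbert

/-! ### Density of finitely supported vectors and self-adjointness of `J` -/

section FiniteSupport

/-- The elements of `ℓ²(ℤ, ℓ²(ℤ))` with finitely many nonzero entries. -/
def finiteSupport : Submodule ℂ (SeqSpace (SeqSpace ℂ)) where
  carrier := {u | (Function.support fun m : ℤ × ℤ => u m.1 m.2).Finite}
  add_mem' hu hv := (hu.union hv).subset (Function.support_add _ _)
  zero_mem' := by
    simp
  smul_mem' c u hu := hu.subset (Function.support_const_smul_subset c _)

theorem single_single_mem_finiteSupport (q r : ℤ) (z : ℂ) :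
    (lp.single 2 q (lp.single 2 r z : SeqSpace ℂ) : SeqSpace (SeqSpace ℂ)) ∈ finiteSupport := by
  refine (Set.finite_singleton (q, r)).subset fun m hm => ?_
  by_contra hne
  apply hm
  simp only [Set.mem_singleton_iff, Prod.ext_iff, not_and_or] at hne
  by_cases hq : m.1 = q
  · simp only [lp.coeFn_single]
    rw [hq, Pi.single_eq_same, lp.coeFn_single, Pi.single_eq_of_ne]
    tauto
  · simp only [lp.coeFn_single]
    rw [Pi.single_eq_of_ne hq]
    rfl

/-- The expansion into coordinates is used twice: `u` is the sum of its rows, and each row, embedded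
isometrically, is the sum of its entries. -/
theorem mem_closure_finiteSupport (u : SeqSpace (SeqSpace ℂ)) :
    u ∈ finiteSupport.topologicalClosure := by
  have : Fact ((1 : ENNReal) ≤ 2) := ⟨by norm_num⟩
  have hmem : ∀ (f : ℤ → SeqSpace (SeqSpace ℂ))
      (v : SeqSpace (SeqSpace ℂ)), HasSum f v →
      (∀ q, f q ∈ finiteSupport.topologicalClosure) →
      v ∈ finiteSupport.topologicalClosure := fun f v hv hf =>
    finiteSupport.isClosed_topologicalClosure.mem_of_tendsto hv
      (Filter.Eventually.of_forall fun s => Submodule.sum_mem _ fun q _ => hf q)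
  refine hmem _ _ (lp.hasSum_single (by norm_num) u) fun q => ?_
  have h := (lp.hasSum_single (p := 2) (by norm_num) (u q)).map
    (lp.singleAddMonoidHom (E := fun _ : ℤ => SeqSpace ℂ) 2 q)
    (lp.isometry_single q).continuous
  exact hmem _ _ h fun r =>
    Submodule.le_topologicalClosure _ (single_single_mem_finiteSupport q r _)

end FiniteSupport

namespace Coeffs

variable {p₁ p₂ : ℕ} [NeZero p₁] [NeZero p₂] (S : Coeffs p₁ p₂)

theorem inner_jacobi (p : ℕ) [NeZero p] (d : ℤ → ℝ) (w : ℤ → ℂ)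
    (hd : ∀ q k : ℤ, d (q + k * p) = d q) (hw : ∀ q k : ℤ, w (q + k * p) = w q)
    (u v : SeqSpace ℂ) : ⟪jacobi p d w hd hw u, v⟫_ℂ = ⟪u, jacobi p d w hd hw v⟫_ℂ :=
  inner_tridiagonal _ _ _ _ _ _
    (fun q x y => by simp [scalarOp]; ring) (fun q x y => by simp [scalarOp]; ring) u v

theorem inner_J (u v : SeqSpace (SeqSpace ℂ)) : ⟪S.J u, v⟫_ℂ = ⟪u, S.J v⟫_ℂ :=
  inner_tridiagonal _ _ _ _ _ _ (fun q x y => inner_jacobi ..)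
    (fun q x y => by rw [add_sub_cancel_right]; exact inner_jacobi ..) u v

/-- The real number `t` is outside the spectrum of `J` if `J - t` is bounded below on finitely
supported vectors. -/
theorem notMem_spectrum_J (t c : ℝ) (hc : 0 < c)
    (h : ∀ u ∈ finiteSupport, c * ‖u‖ ≤ ‖S.J u - (t : ℂ) • u‖) : (t : ℂ) ∉ spectrum ℂ S.J := by
  refine notMem_spectrum_of_bounded_below S.J S.inner_J t c hc fun u => ?_
  have hcl : IsClosed {u : SeqSpace (SeqSpace ℂ) | c * ‖u‖ ≤ ‖S.J u - (t : ℂ) • u‖} :=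
    isClosed_le (by fun_prop) (by fun_prop)
  exact closure_minimal (s := (finiteSupport : Set (SeqSpace (SeqSpace ℂ)))) h hcl
    (mem_closure_finiteSupport u)

end Coeffs

/-! ### Action of the symbol on quasi-periodic sequences -/

/-- Floquet matrices act as the periodic tridiagonal operator on quasi-periodic sequences; `Φ` is
the action of the coefficients. -/
theorem sum_floquet {R M N : Type} [AddCommMonoid R] [Module ℂ R] [AddCommMonoid M] [Module ℂ M]
    [AddCommMonoid N] [Module ℂ N] (Φ : R →ₗ[ℂ] M →ₗ[ℂ] N) (p : ℕ) [NeZero p] (d u l : ℤ → R)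
    (x : ℝ) (V : ℤ → M) (hl : l p = l 0)
    (hV : ∀ q, V (q + p) = Complex.exp (-(Complex.I * x)) • V q) (i : Fin p) :
    ∑ k : Fin p, Φ (floquet p d u l x i k) (V ((k : ℕ) + 1))
      = Φ (l i) (V i) + Φ (d ((i : ℕ) + 1)) (V ((i : ℕ) + 1))
        + Φ (u ((i : ℕ) + 1)) (V ((i : ℕ) + 1 + 1)) := by
  have hp : 0 < p := Nat.pos_of_ne_zero (NeZero.ne p)
  have hD : ∑ k : Fin p, Φ (if i = k then d ((i : ℕ) + 1) else 0) (V ((k : ℕ) + 1))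
      = Φ (d ((i : ℕ) + 1)) (V ((i : ℕ) + 1)) := by
    rw [Finset.sum_eq_single i, if_pos rfl]
    · intro k _ hk
      rw [if_neg (Ne.symm hk)]; simp
    · simp
  -- In each row exactly one of the superdiagonal and the corner contributes; in the last row the
  -- corner phase turns `V 1` into `V (p + 1)`. Treating the summands separately covers the
  -- coinciding positions for `p ≤ 2`.
  have hU : ∑ k : Fin p, Φ (if (k : ℕ) = (i : ℕ) + 1 then u ((i : ℕ) + 1) else 0) (V ((k : ℕ) + 1))
      + ∑ k : Fin p, Φ (if (i : ℕ) + 1 = p ∧ (k : ℕ) = 0 then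
          Complex.exp (-(Complex.I * x)) • u p else 0) (V ((k : ℕ) + 1))
      = Φ (u ((i : ℕ) + 1)) (V ((i : ℕ) + 1 + 1)) := by
    rcases (show (i : ℕ) + 1 ≤ p from i.2).lt_or_eq with h | h
    · rw [Finset.sum_eq_single ⟨(i : ℕ) + 1, h⟩, if_pos rfl, Finset.sum_eq_zero, add_zero]
      · simp
      · intro k _
        rw [if_neg (fun h' => h.ne h'.1)]; simp
      · intro k _ hk
        rw [if_neg (fun h' => hk (Fin.ext h'))]; simp
      · simp
    · have hi : ((i : ℕ) : ℤ) + 1 = p := by exact_mod_cast h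
      rw [Finset.sum_eq_zero, zero_add, Finset.sum_eq_single ⟨0, hp⟩, if_pos ⟨h, rfl⟩, hi,
        add_comm (p : ℤ) 1, hV]
      · simp
      · intro k _ hk
        rw [if_neg (fun h' => hk (Fin.ext h'.2))]; simp
      · simp
      · intro k _
        rw [if_neg (fun h' => by have := k.2; omega)]; simp
  -- Likewise below the diagonal; the first row uses `l p = l 0` and `V 0 = e^{ix} V p`.
  have hL : ∑ k : Fin p, Φ (if (i : ℕ) = (k : ℕ) + 1 then l ((k : ℕ) + 1) else 0) (V ((k : ℕ) + 1))
      + ∑ k : Fin p, Φ (if (i : ℕ) = 0 ∧ (k : ℕ) + 1 = p then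
          Complex.exp (Complex.I * x) • l p else 0) (V ((k : ℕ) + 1))
      = Φ (l i) (V i) := by
    rcases Nat.eq_zero_or_pos (i : ℕ) with h | h
    · have hV0 : V 0 = Complex.exp (Complex.I * x) • V p := by
        rw [← zero_add (p : ℤ), hV, smul_smul, ← Complex.exp_add]; simp
      have hp1 : ((p - 1 : ℕ) : ℤ) + 1 = p := by omega
      rw [Finset.sum_eq_zero, zero_add, Finset.sum_eq_single ⟨p - 1, by omega⟩,
        if_pos ⟨h, by simp; omega⟩, h]
      · simp only [hp1, hl, Nat.cast_zero, hV0, map_smul, LinearMap.smul_apply]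
      · intro k _ hk
        rw [if_neg (fun h' => hk (Fin.ext (by simp; omega)))]; simp
      · simp
      · intro k _
        rw [if_neg (fun h' => by omega)]; simp
    · have hi1 : (((i : ℕ) - 1 : ℕ) : ℤ) + 1 = (i : ℕ) := by omega
      rw [Finset.sum_eq_single ⟨(i : ℕ) - 1, by omega⟩, if_pos (by simp; omega),
        Finset.sum_eq_zero, add_zero]
      · simp only [hi1]
      · intro k _
        rw [if_neg (fun h' => h.ne' h'.1)]; simp
      · intro k _ hk
        rw [if_neg (fun h' => hk (Fin.ext (by simp; omega)))]; simp
      · simp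
  simp only [floquet, Matrix.of_apply, map_add, LinearMap.add_apply, Finset.sum_add_distrib]
  rw [← hD, ← hU, ← hL]
  abel

/-- The Jacobi operator on arbitrary sequences. -/
def jacobiFun (d : ℤ → ℝ) (w : ℤ → ℂ) (v : ℤ → ℂ) (r : ℤ) : ℂ :=
  conj (w (r - 1)) * v (r - 1) + (d r : ℂ) * v r + w r * v (r + 1)

/-- `V` is multiplied by `e^{-ix₁}` and `e^{-ix₂}` under the translations by `(p₁, 0)` and
`(0, p₂)`. -/
def IsQuasiPeriodic (p₁ p₂ : ℕ) (x : ℝ × ℝ) (V : ℤ → ℤ → ℂ) : Prop :=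
  ∀ q r m n : ℤ, V (q + m * p₁) (r + n * p₂)
    = Complex.exp (-(Complex.I * (m * x.1 + n * x.2))) * V q r

theorem IsQuasiPeriodic.left {p₁ p₂ : ℕ} {x : ℝ × ℝ} {V : ℤ → ℤ → ℂ}
    (hV : IsQuasiPeriodic p₁ p₂ x V) (q r : ℤ) :
    V (q + p₁) r = Complex.exp (-(Complex.I * x.1)) * V q r := by
  simpa using hV q r 1 0

theorem IsQuasiPeriodic.right {p₁ p₂ : ℕ} {x : ℝ × ℝ} {V : ℤ → ℤ → ℂ}
    (hV : IsQuasiPeriodic p₁ p₂ x V) (q r : ℤ) :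
    V q (r + p₂) = Complex.exp (-(Complex.I * x.2)) * V q r := by
  simpa using hV q r 0 1

theorem floquet_mulVec (p : ℕ) [NeZero p] (d : ℤ → ℝ) (w : ℤ → ℂ)
    (hw : ∀ q k : ℤ, w (q + k * p) = w q) (x : ℝ) (v : ℤ → ℂ)
    (hv : ∀ r, v (r + p) = Complex.exp (-(Complex.I * x)) * v r) (j : Fin p) :
    (floquet p (fun r => (d r : ℂ)) w (fun r => conj (w r)) x).mulVec
      (fun k => v ((k : ℕ) + 1)) j = jacobiFun d w v ((j : ℕ) + 1) := by
  have h := sum_floquet (LinearMap.mul ℂ ℂ) p (fun r => (d r : ℂ)) w (fun r => conj (w r)) x v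
    (by simpa using congrArg conj (hw 0 1)) hv j
  simpa [Matrix.mulVec, dotProduct, jacobiFun] using h

namespace Coeffs

variable {p₁ p₂ : ℕ} (S : Coeffs p₁ p₂)

/-- The operator `J` on arbitrary double sequences. -/
def latticeOp (V : ℤ → ℤ → ℂ) (q r : ℤ) : ℂ :=
  jacobiFun (S.a (q - 1)) (S.α (q - 1)) (V (q - 1)) r + jacobiFun (S.c q) (S.b q) (V q) r
    + jacobiFun (S.a q) (S.α q) (V (q + 1)) r

/-- Only the nine sites of the surrounding `3 × 3` square enter. This locality confines cut-off
errors to the boundary. -/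
theorem latticeOp_congr {U V : ℤ → ℤ → ℂ} {q r : ℤ}
    (h : ∀ q' r', |q' - q| ≤ 1 → |r' - r| ≤ 1 → U q' r' = V q' r') :
    S.latticeOp U q r = S.latticeOp V q r := by
  simp only [latticeOp, jacobiFun]
  rw [h (q - 1) (r - 1) (by simp) (by simp), h (q - 1) r (by simp) (by simp),
    h (q - 1) (r + 1) (by simp) (by simp), h q (r - 1) (by simp) (by simp),
    h q r (by simp) (by simp), h q (r + 1) (by simp) (by simp),
    h (q + 1) (r - 1) (by simp) (by simp), h (q + 1) r (by simp) (by simp),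
    h (q + 1) (r + 1) (by simp) (by simp)]

theorem latticeOp_zero (q r : ℤ) : S.latticeOp (fun _ _ => 0) q r = 0 := by
  simp [latticeOp, jacobiFun]

theorem latticeOp_const_mul (c : ℂ) (V : ℤ → ℤ → ℂ) (q r : ℤ) :
    S.latticeOp (fun q r => c * V q r) q r = c * S.latticeOp V q r := by
  simp only [latticeOp, jacobiFun]
  ring

theorem latticeOp_translate (V : ℤ → ℤ → ℂ) (q r m n : ℤ) :
    S.latticeOp (fun q r => V (q + m * p₁) (r + n * p₂)) q r
      = S.latticeOp V (q + m * p₁) (r + n * p₂) := by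
  have ha := fun q r => S.a_periodic q r m n
  have hα := fun q r => S.α_periodic q r m n
  have hb := fun q r => S.b_periodic q r m n
  have hc := fun q r => S.c_periodic q r m n
  simp only [latticeOp, jacobiFun, add_sub_right_comm _ _ (1 : ℤ), add_right_comm _ _ (1 : ℤ),
    ha, hα, hb, hc]

theorem hasSum_latticeOp {ι : Type*} {V : ι → ℤ → ℤ → ℂ} {W : ℤ → ℤ → ℂ}
    (h : ∀ q r, HasSum (fun i => V i q r) (W q r)) (q r : ℤ) :
    HasSum (fun i => S.latticeOp (V i) q r) (S.latticeOp W q r) := by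
  have hj : ∀ d w q, HasSum (fun i => jacobiFun d w (V i q) r) (jacobiFun d w (W q) r) :=
    fun d w q => (((h q _).mul_left _).add ((h q _).mul_left _)).add ((h q _).mul_left _)
  exact ((hj _ _ _).add (hj _ _ _)).add (hj _ _ _)

theorem isQuasiPeriodic_latticeOp {x : ℝ × ℝ} {V : ℤ → ℤ → ℂ}
    (hV : IsQuasiPeriodic p₁ p₂ x V) : IsQuasiPeriodic p₁ p₂ x (S.latticeOp V) := by
  intro q r m n
  rw [← latticeOp_translate, ← latticeOp_const_mul]
  simp only [hV _ _ m n]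

theorem symbA_periodic (n : ℤ) (x₂ : ℝ) : S.symbA (n + p₁) x₂ = S.symbA n x₂ := by
  have h1 : S.a (n + p₁) = S.a n := by funext r; simpa using S.a_periodic n r 1 0
  have h2 : S.α (n + p₁) = S.α n := by funext r; simpa using S.α_periodic n r 1 0
  simp only [symbA, h1, h2]

variable [NeZero p₂]

theorem J_apply_apply [NeZero p₁] (u : SeqSpace (SeqSpace ℂ)) (q r : ℤ) :
    S.J u q r = S.latticeOp (fun q r => u q r) q r := by
  rw [J_apply]
  simp only [lp.coeFn_add, Pi.add_apply, A, B, jacobi_apply, latticeOp, jacobiFun]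

theorem symbA_mulVec {x : ℝ × ℝ} {V : ℤ → ℤ → ℂ} (hV : IsQuasiPeriodic p₁ p₂ x V) (n q : ℤ)
    (j : Fin p₂) : (S.symbA n x.2).mulVec (fun k => V q ((k : ℕ) + 1)) j
      = jacobiFun (S.a n) (S.α n) (V q) ((j : ℕ) + 1) :=
  floquet_mulVec p₂ _ _ (fun r k => by simpa using S.α_periodic n r 0 k) _ _ (hV.right q) j

theorem symbB_mulVec {x : ℝ × ℝ} {V : ℤ → ℤ → ℂ} (hV : IsQuasiPeriodic p₁ p₂ x V) (n q : ℤ)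
    (j : Fin p₂) : (S.symbB n x.2).mulVec (fun k => V q ((k : ℕ) + 1)) j
      = jacobiFun (S.c n) (S.b n) (V q) ((j : ℕ) + 1) :=
  floquet_mulVec p₂ _ _ (fun r k => by simpa using S.b_periodic n r 0 k) _ _ (hV.right q) j

/-- `sum_floquet` acts on two levels: with scalar multiplication inside the blocks (via
`floquet_mulVec`), and with matrices acting on vectors for the block structure. -/
theorem symbol_mulVec [NeZero p₁] {x : ℝ × ℝ} {V : ℤ → ℤ → ℂ} (hV : IsQuasiPeriodic p₁ p₂ x V)
    (i : Fin p₁ × Fin p₂) :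
    (S.symbol x).mulVec (fun k => V ((k.1 : ℕ) + 1) ((k.2 : ℕ) + 1)) i
      = S.latticeOp V ((i.1 : ℕ) + 1) ((i.2 : ℕ) + 1) := by
  have h := sum_floquet (Matrix.mulVecBilin ℂ ℂ) p₁ (fun n => S.symbB n x.2)
    (fun n => S.symbA n x.2) (fun n => S.symbA n x.2) x.1
    (fun q (j : Fin p₂) => V q ((j : ℕ) + 1)) (by simpa using S.symbA_periodic 0 x.2)
    (fun q => funext fun j => hV.left q _) i.1
  have h' := congrFun h i.2
  simp only [Finset.sum_apply, Pi.add_apply, Matrix.mulVecBilin_apply, symbA_mulVec S hV,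
    symbB_mulVec S hV] at h'
  rw [latticeOp, add_sub_cancel_right, ← h', Matrix.mulVec, dotProduct, Fintype.sum_prod_type]
  rfl

end Coeffs

/-! ### Fundamental cells and quasi-periodic extension -/

section Cell

theorem IsQuasiPeriodic.norm_add {p₁ p₂ : ℕ} {x : ℝ × ℝ} {V : ℤ → ℤ → ℂ}
    (hV : IsQuasiPeriodic p₁ p₂ x V) (q r m n : ℤ) : ‖V (q + m * p₁) (r + n * p₂)‖ = ‖V q r‖ := by
  rw [hV, norm_mul, Complex.norm_exp]
  simp

/-- Every integer is `i + 1 + m p` for a unique `m` and a unique `i ∈ {0, …, p - 1}`. -/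
def cellEquiv (p : ℕ) [NeZero p] : ℤ × Fin p ≃ ℤ :=
  (Int.divModEquiv p).symm.trans (Equiv.addRight 1)

variable (p : ℕ) [NeZero p]

theorem cellEquiv_apply (m : ℤ) (i : Fin p) : cellEquiv p (m, i) = (i : ℕ) + 1 + m * p := by
  change m * p + ((i : ℕ) : ℤ) + 1 = _
  ring

theorem cellEquiv_symm_add (q m : ℤ) : (cellEquiv p).symm (q + m * p)
    = (((cellEquiv p).symm q).1 + m, ((cellEquiv p).symm q).2) := by
  rw [Equiv.symm_apply_eq, cellEquiv_apply]
  conv_lhs => rw [← (cellEquiv p).apply_symm_apply q, ← Prod.mk.eta (p := (cellEquiv p).symm q),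
    cellEquiv_apply]
  ring

theorem cellEquiv_symm_natCast_succ (i : Fin p) :
    (cellEquiv p).symm ((i : ℕ) + 1) = (0, i) := by
  rw [Equiv.symm_apply_eq, cellEquiv_apply]; ring

/-- The quasi-periodic extension of a vector on the fundamental cell. -/
def quasiExtend (p₁ p₂ : ℕ) [NeZero p₁] [NeZero p₂] (x : ℝ × ℝ) (w : Fin p₁ × Fin p₂ → ℂ)
    (q r : ℤ) : ℂ :=
  Complex.exp (-(Complex.I * (((cellEquiv p₁).symm q).1 * x.1 + ((cellEquiv p₂).symm r).1 * x.2)))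
    * w (((cellEquiv p₁).symm q).2, ((cellEquiv p₂).symm r).2)

variable {p₁ p₂ : ℕ} [NeZero p₁] [NeZero p₂] (x : ℝ × ℝ) (w : Fin p₁ × Fin p₂ → ℂ)

theorem isQuasiPeriodic_quasiExtend : IsQuasiPeriodic p₁ p₂ x (quasiExtend p₁ p₂ x w) := by
  intro q r m n
  simp only [quasiExtend, cellEquiv_symm_add]
  rw [← mul_assoc, ← Complex.exp_add]
  push_cast
  congr 2
  ring

theorem quasiExtend_cell (i : Fin p₁ × Fin p₂) :
    quasiExtend p₁ p₂ x w ((i.1 : ℕ) + 1) ((i.2 : ℕ) + 1) = w i := by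
  simp [quasiExtend, cellEquiv_symm_natCast_succ]

theorem IsQuasiPeriodic.eq_of_eq_on_cell {x : ℝ × ℝ} {V W : ℤ → ℤ → ℂ}
    (hV : IsQuasiPeriodic p₁ p₂ x V) (hW : IsQuasiPeriodic p₁ p₂ x W)
    (h : ∀ i : Fin p₁ × Fin p₂,
      V ((i.1 : ℕ) + 1) ((i.2 : ℕ) + 1) = W ((i.1 : ℕ) + 1) ((i.2 : ℕ) + 1)) (q r : ℤ) :
    V q r = W q r := by
  obtain ⟨⟨m, i⟩, rfl⟩ := (cellEquiv p₁).surjective q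
  obtain ⟨⟨n, j⟩, rfl⟩ := (cellEquiv p₂).surjective r
  rw [cellEquiv_apply, cellEquiv_apply, hV, hW, h (i, j)]

theorem IsQuasiPeriodic.exists_norm_le {x : ℝ × ℝ} {V : ℤ → ℤ → ℂ}
    (hV : IsQuasiPeriodic p₁ p₂ x V) : ∃ C, ∀ q r, ‖V q r‖ ≤ C := by
  refine ⟨∑ i : Fin p₁ × Fin p₂, ‖V ((i.1 : ℕ) + 1) ((i.2 : ℕ) + 1)‖, fun q r => ?_⟩
  obtain ⟨⟨m, i⟩, rfl⟩ := (cellEquiv p₁).surjective q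
  obtain ⟨⟨n, j⟩, rfl⟩ := (cellEquiv p₂).surjective r
  rw [cellEquiv_apply, cellEquiv_apply, hV.norm_add]
  exact Finset.single_le_sum
    (f := fun i : Fin p₁ × Fin p₂ => ‖V ((i.1 : ℕ) + 1) ((i.2 : ℕ) + 1)‖)
    (fun _ _ => norm_nonneg _) (Finset.mem_univ (i, j))

theorem IsPeriodic.exists_norm_le {E : Type} [NormedAddCommGroup E] {f : ℤ → ℤ → E}
    (hf : IsPeriodic p₁ p₂ f) : ∃ C, ∀ q r, ‖f q r‖ ≤ C := by
  -- Periodicity of the norms is quasi-periodicity with trivial phases, so the previous bound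
  -- applies.
  have h : IsQuasiPeriodic p₁ p₂ 0 fun q r => ((‖f q r‖ : ℝ) : ℂ) := fun q r m n => by
    simp [hf q r m n]
  obtain ⟨C, hC⟩ := h.exists_norm_le
  exact ⟨C, fun q r => by simpa using hC q r⟩

end Cell

section FiniteSupport

theorem exists_mem_finiteSupport_eq (U : ℤ → ℤ → ℂ)
    (hU : (Function.support fun m : ℤ × ℤ => U m.1 m.2).Finite) :
    ∃ u ∈ finiteSupport, ∀ q r, u q r = U q r := by
  have h1 : ∀ q, Memℓp (U q) 2 := fun q => by
    refine (memℓp_zero ((hU.image Prod.snd).subset fun r hr => ?_)).of_exponent_ge (by simp)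
    exact ⟨(q, r), hr, rfl⟩
  have h2 : Memℓp (fun q => (⟨U q, h1 q⟩ : SeqSpace ℂ)) 2 := by
    refine (memℓp_zero ((hU.image Prod.fst).subset fun q hq => ?_)).of_exponent_ge (by simp)
    by_contra hcon
    refine hq (lp.ext (funext fun r => ?_))
    by_contra hr
    exact hcon ⟨(q, r), hr, rfl⟩
  exact ⟨⟨_, h2⟩, hU, fun _ _ => rfl⟩

theorem summable_norm_sq_of_finiteSupport {u : SeqSpace (SeqSpace ℂ)} (hu : u ∈ finiteSupport) :
    Summable fun m : ℤ × ℤ => ‖u m.1 m.2‖ ^ 2 :=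
  summable_of_hasFiniteSupport (hu.subset fun m hm h => hm (by simp [h]))

theorem norm_sq_eq_of_finiteSupport {u : SeqSpace (SeqSpace ℂ)} (hu : u ∈ finiteSupport) :
    ‖u‖ ^ 2 = ∑' m : ℤ × ℤ, ‖u m.1 m.2‖ ^ 2 := by
  rw [(summable_norm_sq_of_finiteSupport hu).tsum_prod, norm_sq_eq]
  exact tsum_congr fun q => norm_sq_eq _

end FiniteSupport

/-! ### Generalized eigenfunctions, their cut-offs, and bands inside the spectrum -/

namespace Coeffs

variable {p₁ p₂ : ℕ} (S : Coeffs p₁ p₂)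

theorem exists_eigenvector (k : Fin (p₁ * p₂)) (x : ℝ × ℝ) : ∃ w : Fin p₁ × Fin p₂ → ℂ, w ≠ 0 ∧
    (S.symbol x).mulVec w = (S.eigenvalue k x : ℂ) • w := by
  have hs := Matrix.isSymmetric_toEuclideanLin_iff.mpr (S.symbol_isHermitian x)
  set k' : Fin (Fintype.card (Fin p₁ × Fin p₂)) := Fin.cast (by simp) k
  refine ⟨WithLp.ofLp (hs.eigenvectorBasis finrank_euclideanSpace k'), ?_, ?_⟩
  · have h := (hs.eigenvectorBasis finrank_euclideanSpace).orthonormal.ne_zero k'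
    simpa using h
  · exact congrArg WithLp.ofLp (hs.apply_eigenvectorBasis finrank_euclideanSpace k')

variable [NeZero p₁] [NeZero p₂]

/-- A supremum bound, since each entry of the cut-off error must be bounded independently of the box
size. -/
theorem exists_norm_latticeOp_le : ∃ K, 0 ≤ K ∧ ∀ (V : ℤ → ℤ → ℂ) (C : ℝ), 0 ≤ C →
    (∀ q r, ‖V q r‖ ≤ C) → ∀ q r, ‖S.latticeOp V q r‖ ≤ K * C := by
  obtain ⟨Ca, ha⟩ := S.a_periodic.exists_norm_le
  obtain ⟨Cα, hα⟩ := S.α_periodic.exists_norm_le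
  obtain ⟨Cb, hb⟩ := S.b_periodic.exists_norm_le
  obtain ⟨Cc, hc⟩ := S.c_periodic.exists_norm_le
  have a0 := (norm_nonneg _).trans (ha 0 0)
  have α0 := (norm_nonneg _).trans (hα 0 0)
  have b0 := (norm_nonneg _).trans (hb 0 0)
  have c0 := (norm_nonneg _).trans (hc 0 0)
  have hj : ∀ (d : ℤ → ℝ) (w v : ℤ → ℂ) (D W C : ℝ), 0 ≤ D → 0 ≤ W → (∀ r, ‖d r‖ ≤ D) →
      (∀ r, ‖w r‖ ≤ W) → (∀ r, ‖v r‖ ≤ C) → ∀ r, ‖jacobiFun d w v r‖ ≤ (W + D + W) * C := by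
    intro d w v D W C hD hW hd hw hv r
    have h := norm_add₃_le (a := conj (w (r - 1)) * v (r - 1)) (b := (d r : ℂ) * v r)
      (c := w r * v (r + 1))
    refine h.trans ?_
    rw [norm_mul, norm_mul, norm_mul, RCLike.norm_conj, Complex.norm_real, add_mul, add_mul]
    gcongr
    exacts [hw _, hv _, hd _, hv _, hw _, hv _]
  refine ⟨(Cα + Ca + Cα) + (Cb + Cc + Cb) + (Cα + Ca + Cα), by positivity,
    fun V C hC hV q r => ?_⟩
  refine norm_add₃_le.trans ?_
  rw [add_mul _ _ C, add_mul _ _ C]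
  gcongr
  · exact hj _ _ _ _ _ _ a0 α0 (ha _) (hα _) (hV _) _
  · exact hj _ _ _ _ _ _ c0 b0 (hc _) (hb _) (hV _) _
  · exact hj _ _ _ _ _ _ a0 α0 (ha _) (hα _) (hV _) _

/-- A bounded generalized eigenfunction for every eigenvalue of the symbol. -/
theorem exists_quasiPeriodic_eigenfunction (k : Fin (p₁ * p₂)) (x : ℝ × ℝ) :
    ∃ V : ℤ → ℤ → ℂ, IsQuasiPeriodic p₁ p₂ x V ∧ (∃ q r, V q r ≠ 0) ∧
      ∀ q r, S.latticeOp V q r = S.eigenvalue k x * V q r := by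
  obtain ⟨w, hw0, hw⟩ := S.exists_eigenvector k x
  have hV := isQuasiPeriodic_quasiExtend x w
  -- Both sides of the eigenvalue equation are quasi-periodic, so it suffices to check it on the
  -- cell, where it is the equation for `w`.
  refine ⟨_, hV, ?_, (S.isQuasiPeriodic_latticeOp hV).eq_of_eq_on_cell
    (W := fun q r => S.eigenvalue k x * quasiExtend p₁ p₂ x w q r) ?_ fun i => ?_⟩
  · obtain ⟨i, hi⟩ := Function.ne_iff.1 hw0
    exact ⟨_, _, by rw [quasiExtend_cell x w i]; exact hi⟩
  · intro q r m n
    beta_reduce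
    rw [hV, mul_left_comm]
  · rw [← symbol_mulVec S hV]
    simp only [quasiExtend_cell]
    exact congrFun hw i

end Coeffs

/-- The frame of sites near the boundary of an `a × b` box grows linearly in the side lengths,
against `ab` sites in the box. -/
theorem card_boundary_le (a b : ℕ) :
    ((({0, 1, (a : ℤ), (a : ℤ) + 1} : Finset ℤ) ×ˢ Finset.Icc 0 ((b : ℤ) + 1)
      ∪ Finset.Icc 0 ((a : ℤ) + 1) ×ˢ ({0, 1, (b : ℤ), (b : ℤ) + 1} : Finset ℤ)).card)
      ≤ 4 * (b + 2) + (a + 2) * 4 := by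
  refine (Finset.card_union_le _ _).trans ?_
  rw [Finset.card_product, Finset.card_product, Int.card_Icc, Int.card_Icc]
  have h1 : ((b : ℤ) + 1 + 1 - 0).toNat = b + 2 := by omega
  have h2 : ((a : ℤ) + 1 + 1 - 0).toNat = a + 2 := by omega
  rw [h1, h2]
  gcongr <;> exact Finset.card_le_four

namespace Coeffs

variable {p₁ p₂ : ℕ} (S : Coeffs p₁ p₂)

theorem finite_support_latticeOp {U : ℤ → ℤ → ℂ}
    (hU : (Function.support fun m : ℤ × ℤ => U m.1 m.2).Finite) :
    (Function.support fun m : ℤ × ℤ => S.latticeOp U m.1 m.2).Finite := by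
  have hfin : (Set.Icc (-1 : ℤ × ℤ) 1).Finite := Set.finite_Icc _ _
  refine (hU.image2 (fun m k => m + k) hfin).subset fun m hm => ?_
  by_contra hcon
  refine hm ?_
  change S.latticeOp U m.1 m.2 = 0
  rw [← S.latticeOp_zero m.1 m.2]
  refine S.latticeOp_congr fun q' r' hq hr => ?_
  by_contra hne
  rw [abs_le] at hq hr
  refine hcon ⟨(q', r'), hne, (m.1 - q', m.2 - r'), ⟨⟨?_, ?_⟩, ⟨?_, ?_⟩⟩, ?_⟩
  · change -1 ≤ m.1 - q'; omega
  · change -1 ≤ m.2 - r'; omega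
  · change m.1 - q' ≤ 1; omega
  · change m.2 - r' ≤ 1; omega
  · ext <;> simp

/-- Cutting a generalized eigenfunction off at the boundary of the box `[1, a] × [1, b]` creates
errors only near that boundary. -/
theorem latticeOp_cutoff {V : ℤ → ℤ → ℂ} {t : ℂ} (hV : ∀ q r, S.latticeOp V q r = t * V q r)
    (a b : ℤ) {U : ℤ → ℤ → ℂ}
    (hU : ∀ q r, U q r = if (1 ≤ q ∧ q ≤ a) ∧ (1 ≤ r ∧ r ≤ b) then V q r else 0) {m : ℤ × ℤ}
    (hm : m ∉ ({0, 1, a, a + 1} : Finset ℤ) ×ˢ Finset.Icc 0 (b + 1)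
      ∪ Finset.Icc 0 (a + 1) ×ˢ ({0, 1, b, b + 1} : Finset ℤ)) :
    S.latticeOp U m.1 m.2 = t * U m.1 m.2 := by
  obtain ⟨q, r⟩ := m
  simp only [Finset.mem_union, Finset.mem_product, Finset.mem_insert, Finset.mem_singleton,
    Finset.mem_Icc, not_or, not_and_or, not_le] at hm
  -- Off the frame, the `3 × 3` square around the site lies entirely inside or entirely outside the
  -- box.
  by_cases hin : (1 ≤ q ∧ q ≤ a) ∧ (1 ≤ r ∧ r ≤ b)
  · rw [hU q r, if_pos hin, ← hV q r]
    refine S.latticeOp_congr fun q' r' hq hr => ?_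
    rw [abs_le] at hq hr
    rw [hU, if_pos (by omega)]
  · rw [hU q r, if_neg hin, mul_zero, ← S.latticeOp_zero q r]
    refine S.latticeOp_congr fun q' r' hq hr => ?_
    rw [abs_le] at hq hr
    rw [hU, if_neg (by omega)]

variable [NeZero p₁] [NeZero p₂]

theorem J_mem_finiteSupport {u : SeqSpace (SeqSpace ℂ)} (hu : u ∈ finiteSupport) :
    S.J u ∈ finiteSupport := by
  have h := S.finite_support_latticeOp (U := fun q r => u q r) hu
  simp only [← J_apply_apply] at h
  exact h

theorem J_sub_smul_apply_apply (t : ℂ) (u : SeqSpace (SeqSpace ℂ)) (q r : ℤ) :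
    (S.J u - t • u) q r = S.latticeOp (fun q r => u q r) q r - t * u q r := by
  rw [← J_apply_apply]
  rfl

theorem J_sub_smul_mem_finiteSupport (t : ℂ) {u : SeqSpace (SeqSpace ℂ)}
    (hu : u ∈ finiteSupport) : S.J u - t • u ∈ finiteSupport :=
  Submodule.sub_mem _ (S.J_mem_finiteSupport hu) (Submodule.smul_mem _ _ hu)

/-- The box consists of `N²` translated cells, each containing one translate of `(q₀, r₀)`, and
`‖V‖` is the same at all of them. -/
theorem sum_norm_sq_le {V : ℤ → ℤ → ℂ} {x : ℝ × ℝ} (hV : IsQuasiPeriodic p₁ p₂ x V)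
    (u : SeqSpace (SeqSpace ℂ)) (hu : u ∈ finiteSupport) (N : ℕ)
    (h : ∀ q r, u q r = if (1 ≤ q ∧ q ≤ (N * p₁ : ℕ)) ∧ (1 ≤ r ∧ r ≤ (N * p₂ : ℕ))
      then V q r else 0) (q₀ r₀ : ℤ) :
    (N : ℝ) ^ 2 * ‖V q₀ r₀‖ ^ 2 ≤ ‖u‖ ^ 2 := by
  obtain ⟨⟨m, i⟩, rfl⟩ := (cellEquiv p₁).surjective q₀
  obtain ⟨⟨n, j⟩, rfl⟩ := (cellEquiv p₂).surjective r₀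
  rw [cellEquiv_apply, cellEquiv_apply, hV.norm_add]
  set g : Fin N × Fin N → ℤ × ℤ := fun k =>
    (cellEquiv p₁ ((k.1 : ℕ), i), cellEquiv p₂ ((k.2 : ℕ), j)) with hg
  have hginj : Function.Injective g := by
    rintro ⟨k, l⟩ ⟨k', l'⟩ hkl
    simp only [hg, Prod.mk.injEq, EmbeddingLike.apply_eq_iff_eq, Nat.cast_inj, and_true] at hkl
    ext
    exacts [hkl.1, hkl.2]
  have hval : ∀ k, ‖u (g k).1 (g k).2‖ ^ 2 = ‖V ((i : ℕ) + 1) ((j : ℕ) + 1)‖ ^ 2 := by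
    intro k
    have aux : ∀ (p : ℕ) (i : Fin p) (k : Fin N),
        1 ≤ ((i : ℕ) : ℤ) + 1 + (k : ℕ) * p ∧ ((i : ℕ) : ℤ) + 1 + (k : ℕ) * p ≤ (N * p : ℕ) := by
      intro p i k
      have h1 : (i : ℕ) + 1 + (k : ℕ) * p ≤ N * p := by
        calc (i : ℕ) + 1 + (k : ℕ) * p ≤ p + (k : ℕ) * p := by have := i.2; omega
          _ = ((k : ℕ) + 1) * p := by ring
          _ ≤ N * p := Nat.mul_le_mul_right _ k.2
      exact ⟨by exact_mod_cast (by omega : 1 ≤ (i : ℕ) + 1 + (k : ℕ) * p), by exact_mod_cast h1⟩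
    simp only [hg, cellEquiv_apply]
    rw [h, if_pos, hV.norm_add]
    exact ⟨aux _ _ _, aux _ _ _⟩
  rw [norm_sq_eq_of_finiteSupport hu]
  refine le_trans (le_of_eq ?_) ((summable_norm_sq_of_finiteSupport hu).sum_le_tsum
    (Finset.univ.map ⟨g, hginj⟩) fun _ _ => by positivity)
  rw [Finset.sum_map]
  simp only [Function.Embedding.coeFn_mk, hval]
  simp [sq]

/-- Eigenvalues of the symbol belong to the spectrum of `J`. -/
theorem eigenvalue_mem_spectrum (k : Fin (p₁ * p₂)) (x : ℝ × ℝ) :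
    (S.eigenvalue k x : ℂ) ∈ spectrum ℂ S.J := by
  by_contra hcon
  obtain ⟨c, hc, hbelow⟩ := bounded_below_of_notMem_spectrum _ _ hcon
  obtain ⟨V, hV, ⟨q₀, r₀, h0⟩, heig⟩ := S.exists_quasiPeriodic_eigenfunction k x
  obtain ⟨C, hC⟩ := hV.exists_norm_le
  have hC0 : 0 ≤ C := (norm_nonneg _).trans (hC 0 0)
  obtain ⟨K, hK0, hK⟩ := S.exists_norm_latticeOp_le
  set t : ℂ := (S.eigenvalue k x : ℂ)
  -- The left side is quadratic in `N` (mass of the cut-off), the right side linear (frame size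
  -- times a uniform error bound).
  have key : ∀ N : ℕ, c ^ 2 * (N ^ 2 * ‖V q₀ r₀‖ ^ 2)
      ≤ (4 * (N * p₂ + 2) + (N * p₁ + 2) * 4) * (K * C + ‖t‖ * C) ^ 2 := by
    intro N
    set F := ({0, 1, ((N * p₁ : ℕ) : ℤ), ((N * p₁ : ℕ) : ℤ) + 1} : Finset ℤ)
        ×ˢ Finset.Icc 0 (((N * p₂ : ℕ) : ℤ) + 1)
      ∪ Finset.Icc 0 (((N * p₁ : ℕ) : ℤ) + 1)
        ×ˢ ({0, 1, ((N * p₂ : ℕ) : ℤ), ((N * p₂ : ℕ) : ℤ) + 1} : Finset ℤ) with hF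
    obtain ⟨u, hu, huV⟩ := exists_mem_finiteSupport_eq (fun q r =>
      if (1 ≤ q ∧ q ≤ (N * p₁ : ℕ)) ∧ (1 ≤ r ∧ r ≤ (N * p₂ : ℕ)) then V q r else 0) (by
        refine (Set.finite_Icc (1 : ℤ × ℤ) (((N * p₁ : ℕ) : ℤ), ((N * p₂ : ℕ) : ℤ))).subset
          fun m hm => ?_
        rw [Function.mem_support, ne_eq, ite_eq_right_iff, not_forall] at hm
        obtain ⟨h, -⟩ := hm
        exact ⟨⟨h.1.1, h.2.1⟩, ⟨h.1.2, h.2.2⟩⟩)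
    have hulow := sum_norm_sq_le hV u hu N huV q₀ r₀
    have huC : ∀ q r, ‖u q r‖ ≤ C := fun q r => by
      rw [huV]
      split_ifs
      exacts [hC _ _, by simpa using hC0]
    have hres : ‖S.J u - t • u‖ ^ 2 ≤ (F.card : ℝ) * (K * C + ‖t‖ * C) ^ 2 := by
      rw [norm_sq_eq_of_finiteSupport (S.J_sub_smul_mem_finiteSupport t hu),
        tsum_eq_sum (s := F), ← nsmul_eq_mul]
      · refine Finset.sum_le_card_nsmul _ _ _ fun m _ => ?_
        gcongr
        rw [J_sub_smul_apply_apply]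
        refine (norm_sub_le _ _).trans (add_le_add (hK _ C hC0 huC _ _) ?_)
        rw [norm_mul]
        gcongr
        exact huC _ _
      · intro m hm
        rw [J_sub_smul_apply_apply,
          S.latticeOp_cutoff heig _ _ (U := fun q r => u q r) huV hm, sub_self]
        simp
    have hcard : (F.card : ℝ) ≤ 4 * (N * p₂ + 2) + (N * p₁ + 2) * 4 := by
      exact_mod_cast card_boundary_le (N * p₁) (N * p₂)
    calc c ^ 2 * (N ^ 2 * ‖V q₀ r₀‖ ^ 2) ≤ c ^ 2 * ‖u‖ ^ 2 := by gcongr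
      _ = (c * ‖u‖) ^ 2 := by ring
      _ ≤ ‖S.J u - t • u‖ ^ 2 := by gcongr; exact hbelow u
      _ ≤ _ := hres
      _ ≤ _ := by gcongr
  have hpos : 0 < c ^ 2 * ‖V q₀ r₀‖ ^ 2 := by positivity
  obtain ⟨N, hN⟩ := exists_nat_gt
    ((4 * (p₂ + 2) + (p₁ + 2) * 4) * (K * C + ‖t‖ * C) ^ 2 / (c ^ 2 * ‖V q₀ r₀‖ ^ 2))
  rw [div_lt_iff₀ hpos] at hN
  have hN1 : (1 : ℝ) ≤ N := by
    have : (0 : ℝ) < N := by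
      by_contra h
      have h' : (N : ℝ) * (c ^ 2 * ‖V q₀ r₀‖ ^ 2) ≤ 0 :=
        mul_nonpos_of_nonpos_of_nonneg (not_lt.1 h) hpos.le
      have h'' : 0 ≤ (4 * ((p₂ : ℝ) + 2) + (p₁ + 2) * 4) * (K * C + ‖t‖ * C) ^ 2 := by positivity
      linarith
    exact_mod_cast this
  have h1 := key N
  -- `N ≥ 1` absorbs the constants, `2 ≤ 2N`, so that one factor `N` can be extracted.
  have h2 : (4 * ((N : ℝ) * p₂ + 2) + (N * p₁ + 2) * 4) * (K * C + ‖t‖ * C) ^ 2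
      ≤ N * ((4 * (p₂ + 2) + (p₁ + 2) * 4) * (K * C + ‖t‖ * C) ^ 2) := by
    rw [← mul_assoc]
    gcongr
    linarith
  have h3 : (N : ℝ) * ((4 * (p₂ + 2) + (p₁ + 2) * 4) * (K * C + ‖t‖ * C) ^ 2)
      < N * (N * (c ^ 2 * ‖V q₀ r₀‖ ^ 2)) := by gcongr
  have h4 : c ^ 2 * ((N : ℝ) ^ 2 * ‖V q₀ r₀‖ ^ 2) = N * (N * (c ^ 2 * ‖V q₀ r₀‖ ^ 2)) := by ring
  linarith

end Coeffs

/-! ### Discrete Parseval identity on grids of the torus -/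

section Parseval

/-- The grid points `2πj/N`. -/
def gridPoint (N : ℕ) (j : Fin N) : ℝ := 2 * Real.pi * (j : ℕ) / N

/-- A geometric sum over powers of an `N`-th root of unity; `|k| < N` makes the root differ from `1`
unless `k = 0`. -/
theorem sum_exp_gridPoint (N : ℕ) (hN : 0 < N) (k : ℤ) (hk : |k| < N) :
    ∑ j : Fin N, Complex.exp (Complex.I * (k * gridPoint N j)) = if k = 0 then (N : ℂ) else 0 := by
  split_ifs with h
  · simp [h]
  have hN' : (N : ℂ) ≠ 0 := by exact_mod_cast hN.ne'
  set z : ℂ := Complex.exp (k / N * (2 * Real.pi * Complex.I)) with hz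
  have hpow : ∀ j : ℕ, z ^ j = Complex.exp (j * (k / N * (2 * Real.pi * Complex.I))) :=
    fun j => (Complex.exp_nat_mul _ _).symm
  have hsum : ∑ j : Fin N, Complex.exp (Complex.I * (k * gridPoint N j))
      = ∑ j ∈ Finset.range N, z ^ j := by
    rw [Finset.sum_range]
    refine Finset.sum_congr rfl fun j _ => ?_
    rw [hpow, gridPoint]
    push_cast
    congr 1
    ring
  have hz1 : z ≠ 1 := by
    rw [hz, ne_eq, Complex.exp_eq_one_iff]
    rintro ⟨n, hn⟩
    rw [mul_left_inj' Complex.two_pi_I_ne_zero, div_eq_iff hN'] at hn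
    have hn' : k = n * N := by exact_mod_cast hn
    have hn0 : n ≠ 0 := by rintro rfl; simp at hn'; exact h hn'
    rw [hn', abs_mul, Nat.abs_cast] at hk
    have := Int.one_le_abs hn0
    nlinarith
  have hzN : z ^ N = 1 := by
    rw [hpow, Complex.exp_eq_one_iff]
    exact ⟨k, by field_simp⟩
  have h0 := mul_geom_sum z N
  rw [hzN, sub_self] at h0
  rw [hsum]
  exact (mul_eq_zero.1 h0).resolve_left (sub_ne_zero.2 hz1)

/-- The frequencies differ by less than `N`, so there is no aliasing and distinct exponentials are
orthogonal on the grid. -/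
theorem sum_norm_sq_trigPoly (N : ℕ) (hN : 0 < N) (s : Finset ℤ)
    (hs : ∀ m ∈ s, ∀ n ∈ s, |m - n| < N) (g : ℤ → ℂ) :
    ∑ j : Fin N, ‖∑ m ∈ s, Complex.exp (Complex.I * (m * gridPoint N j)) * g m‖ ^ 2
      = N * ∑ m ∈ s, ‖g m‖ ^ 2 := by
  have h : ∀ z : ℂ, ((‖z‖ ^ 2 : ℝ) : ℂ) = z * conj z := fun z => by
    rw [Complex.mul_conj, Complex.normSq_eq_norm_sq]
  have hexp : ∀ (m n : ℤ) (j : Fin N),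
      Complex.exp (Complex.I * (m * gridPoint N j)) * g m
        * conj (Complex.exp (Complex.I * (n * gridPoint N j)) * g n)
      = g m * conj (g n) * Complex.exp (Complex.I * ((m - n : ℤ) * gridPoint N j)) := by
    intro m n j
    rw [map_mul, ← Complex.exp_conj, mul_mul_mul_comm, ← Complex.exp_add, mul_comm]
    simp only [map_mul, Complex.conj_I, Complex.conj_ofReal, map_intCast]
    push_cast
    congr 2
    ring
  rw [← Complex.ofReal_inj]
  simp only [Complex.ofReal_sum, Complex.ofReal_mul, h, map_sum, Finset.sum_mul_sum, hexp,
    Complex.ofReal_natCast]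
  rw [Finset.sum_comm, Finset.mul_sum]
  refine Finset.sum_congr rfl fun m hm => ?_
  rw [Finset.sum_comm]
  simp only [← Finset.mul_sum]
  rw [Finset.sum_eq_single m]
  · rw [sum_exp_gridPoint N hN _ (hs m hm m hm), sub_self, if_pos rfl]
    ring
  · intro n hn hnm
    rw [sum_exp_gridPoint N hN _ (hs m hm n hn), if_neg (sub_ne_zero.2 hnm.symm), mul_zero]
  · exact fun h => absurd hm h

/-- The discrete Parseval identity for trigonometric polynomials of two variables. -/
theorem eventually_sum_norm_sq_trigPoly (f : ℤ × ℤ → ℂ) (hf : f.support.Finite) :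
    ∀ᶠ N : ℕ in Filter.atTop, ∑ j : Fin N × Fin N,
      ‖∑' m : ℤ × ℤ, Complex.exp (Complex.I * (m.1 * gridPoint N j.1 + m.2 * gridPoint N j.2))
        * f m‖ ^ 2 = N ^ 2 * ∑' m, ‖f m‖ ^ 2 := by
  obtain ⟨s, t, hst⟩ : ∃ s t : Finset ℤ, ∀ m, m ∉ s ×ˢ t → f m = 0 := by
    refine ⟨hf.toFinset.image Prod.fst, hf.toFinset.image Prod.snd, fun m hm => ?_⟩
    by_contra h
    have hm' : m ∈ hf.toFinset := hf.mem_toFinset.2 h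
    exact hm (Finset.mem_product.2
      ⟨Finset.mem_image_of_mem _ hm', Finset.mem_image_of_mem _ hm'⟩)
  have hbound : ∀ s : Finset ℤ, ∀ᶠ N : ℕ in Filter.atTop, ∀ m ∈ s, ∀ n ∈ s, |m - n| < N := by
    intro s
    simp only [Filter.eventually_all_finset]
    intro m _ n _
    filter_upwards [Filter.eventually_gt_atTop (m - n).natAbs] with N hN
    rw [Int.abs_eq_natAbs]
    exact_mod_cast hN
  filter_upwards [hbound s, hbound t, Filter.eventually_gt_atTop 0] with N hs ht hN
  rw [tsum_eq_sum (s := s ×ˢ t) fun m hm => by rw [hst m hm]; simp]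
  have h1 : ∀ j : Fin N × Fin N,
      ∑' m : ℤ × ℤ, Complex.exp (Complex.I * (m.1 * gridPoint N j.1 + m.2 * gridPoint N j.2)) * f m
      = ∑ m₁ ∈ s, Complex.exp (Complex.I * (m₁ * gridPoint N j.1)) *
          ∑ m₂ ∈ t, Complex.exp (Complex.I * (m₂ * gridPoint N j.2)) * f (m₁, m₂) := by
    intro j
    rw [tsum_eq_sum (s := s ×ˢ t) fun m hm => by rw [hst m hm]; simp, Finset.sum_product]
    refine Finset.sum_congr rfl fun m₁ _ => ?_
    rw [Finset.mul_sum]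
    refine Finset.sum_congr rfl fun m₂ _ => ?_
    rw [mul_add, Complex.exp_add, mul_assoc]
  simp only [h1]
  rw [Fintype.sum_prod_type_right]
  simp only [sum_norm_sq_trigPoly N hN s hs]
  rw [← Finset.mul_sum, Finset.sum_comm]
  simp only [sum_norm_sq_trigPoly N hN t ht]
  rw [← Finset.mul_sum, Finset.sum_product, sq, mul_assoc]

end Parseval

/-! ### The Floquet transform and Plancherel's identity -/

section Floquet

variable (p₁ p₂ : ℕ)

/-- The Floquet transform of a double sequence. -/
def floquetTransform (x : ℝ × ℝ) (U : ℤ → ℤ → ℂ) (q r : ℤ) : ℂ :=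
  ∑' m : ℤ × ℤ, Complex.exp (Complex.I * (m.1 * x.1 + m.2 * x.2))
    * U (q + m.1 * p₁) (r + m.2 * p₂)

variable {p₁ p₂}

theorem isQuasiPeriodic_floquetTransform (x : ℝ × ℝ) (U : ℤ → ℤ → ℂ) :
    IsQuasiPeriodic p₁ p₂ x (floquetTransform p₁ p₂ x U) := by
  intro q r m n
  rw [floquetTransform, floquetTransform, ← tsum_mul_left,
    ← (Equiv.addRight ((m, n) : ℤ × ℤ)).tsum_eq fun k : ℤ × ℤ =>
      Complex.exp (-(Complex.I * (m * x.1 + n * x.2))) *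
        (Complex.exp (Complex.I * (k.1 * x.1 + k.2 * x.2)) * U (q + k.1 * p₁) (r + k.2 * p₂))]
  refine tsum_congr fun k => ?_
  simp only [Equiv.coe_addRight, Prod.fst_add, Prod.snd_add]
  rw [← mul_assoc, ← Complex.exp_add]
  push_cast
  congr 2
  · ring
  · ring
  · ring

variable [NeZero p₁] [NeZero p₂]

theorem finite_support_translate {U : ℤ → ℤ → ℂ}
    (hU : (Function.support fun m : ℤ × ℤ => U m.1 m.2).Finite) (q r : ℤ) :
    (Function.support fun m : ℤ × ℤ => U (q + m.1 * p₁) (r + m.2 * p₂)).Finite := by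
  have h : ∀ (p : ℕ) [NeZero p] (a b : ℤ), a * p = b * p → a = b := fun p _ a b h =>
    mul_right_cancel₀ (by exact_mod_cast NeZero.ne p) h
  refine hU.preimage (f := fun m : ℤ × ℤ => (q + m.1 * p₁, r + m.2 * p₂)) ?_
  rintro ⟨a, b⟩ - ⟨a', b'⟩ - hab
  simp only [Prod.mk.injEq, add_right_inj] at hab
  rw [h p₁ a a' hab.1, h p₂ b b' hab.2]

theorem hasSum_floquetTransform (x : ℝ × ℝ) {U : ℤ → ℤ → ℂ}
    (hU : (Function.support fun m : ℤ × ℤ => U m.1 m.2).Finite) (q r : ℤ) :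
    HasSum (fun m : ℤ × ℤ => Complex.exp (Complex.I * (m.1 * x.1 + m.2 * x.2))
      * U (q + m.1 * p₁) (r + m.2 * p₂)) (floquetTransform p₁ p₂ x U q r) :=
  (summable_of_hasFiniteSupport ((finite_support_translate hU q r).subset
    (Function.support_mul_subset_right _ _))).hasSum

/-- The lattice splits into the cosets of the period lattice, one for each site of the cell. -/
theorem norm_sq_eq_sum_cell {u : SeqSpace (SeqSpace ℂ)} (hu : u ∈ finiteSupport) :
    ‖u‖ ^ 2 = ∑ i : Fin p₁ × Fin p₂, ∑' m : ℤ × ℤ,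
      ‖u ((i.1 : ℕ) + 1 + m.1 * p₁) ((i.2 : ℕ) + 1 + m.2 * p₂)‖ ^ 2 := by
  set e : (Fin p₁ × Fin p₂) × (ℤ × ℤ) ≃ ℤ × ℤ := (Equiv.prodComm _ _).trans
    ((Equiv.prodProdProdComm _ _ _ _).trans ((cellEquiv p₁).prodCongr (cellEquiv p₂))) with he
  have he' : ∀ k, e k = ((k.1.1 : ℕ) + 1 + k.2.1 * p₁, (k.1.2 : ℕ) + 1 + k.2.2 * p₂) := fun k => by
    rw [← cellEquiv_apply, ← cellEquiv_apply]
    rfl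
  have hs := summable_norm_sq_of_finiteSupport hu
  rw [norm_sq_eq_of_finiteSupport hu, ← e.tsum_eq]
  refine ((e.summable_iff.2 hs).tsum_prod).trans ?_
  rw [tsum_fintype]
  simp only [Function.comp_apply, he']

/-- Plancherel's identity for the Floquet transform. -/
theorem eventually_norm_sq_eq_sum_floquetTransform {u : SeqSpace (SeqSpace ℂ)}
    (hu : u ∈ finiteSupport) :
    ∀ᶠ N : ℕ in Filter.atTop, N ^ 2 * ‖u‖ ^ 2 = ∑ j : Fin N × Fin N, ∑ i : Fin p₁ × Fin p₂,
      ‖floquetTransform p₁ p₂ (gridPoint N j.1, gridPoint N j.2) (fun q r => u q r)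
        ((i.1 : ℕ) + 1) ((i.2 : ℕ) + 1)‖ ^ 2 := by
  -- At a fixed cell site the transform is a trigonometric polynomial in `x` whose coefficients are
  -- the values of `u` on the coset. There are finitely many sites, so one `N` serves all.
  have h : ∀ i : Fin p₁ × Fin p₂, _ := fun i => eventually_sum_norm_sq_trigPoly
    (fun m => u ((i.1 : ℕ) + 1 + m.1 * p₁) ((i.2 : ℕ) + 1 + m.2 * p₂))
    (finite_support_translate (U := fun q r => u q r) hu _ _)
  filter_upwards [Filter.eventually_all.2 h] with N hN
  rw [norm_sq_eq_sum_cell (p₁ := p₁) (p₂ := p₂) hu, Finset.mul_sum, Finset.sum_comm]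
  exact Finset.sum_congr rfl fun i _ => (hN i).symm

end Floquet

/-! ### Resolvent set outside the bands, and the spectrum -/

namespace Coeffs

variable {p₁ p₂ : ℕ} (S : Coeffs p₁ p₂)

theorem sum_norm_sq_symbol_le (t δ : ℝ) (hδ : 0 ≤ δ) (x : ℝ × ℝ)
    (h : ∀ k, δ ≤ |S.eigenvalue k x - t|) (w : Fin p₁ × Fin p₂ → ℂ) :
    δ ^ 2 * ∑ i, ‖w i‖ ^ 2 ≤ ∑ i, ‖(S.symbol x).mulVec w i - t * w i‖ ^ 2 := by
  have h1 := le_norm_apply_sub_smul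
    (Matrix.isSymmetric_toEuclideanLin_iff.mpr (S.symbol_isHermitian x)) finrank_euclideanSpace
    t δ hδ (fun j => h (Fin.cast (by simp) j)) (WithLp.toLp 2 w)
  rw [EuclideanSpace.norm_sq_eq, EuclideanSpace.norm_sq_eq] at h1
  exact h1

variable [NeZero p₁] [NeZero p₂]

/-- Translations by periods commute with the lattice operator, which also passes through the
finitely supported sum over `m`. -/
theorem floquetTransform_J_sub_smul (x : ℝ × ℝ) (t : ℂ) {u : SeqSpace (SeqSpace ℂ)}
    (hu : u ∈ finiteSupport) (q r : ℤ) :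
    floquetTransform p₁ p₂ x (fun q r => (S.J u - t • u) q r) q r
      = S.latticeOp (floquetTransform p₁ p₂ x fun q r => u q r) q r
        - t * floquetTransform p₁ p₂ x (fun q r => u q r) q r := by
  have h := hasSum_floquetTransform (p₁ := p₁) (p₂ := p₂) x (U := fun q r => u q r) hu
  have h' := (S.hasSum_latticeOp h q r).sub ((h q r).mul_left t)
  rw [← h'.tsum_eq, floquetTransform]
  refine tsum_congr fun m => ?_
  rw [J_sub_smul_apply_apply, latticeOp_const_mul,
    S.latticeOp_translate (fun q r => u q r) q r m.1 m.2]
  ring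

theorem bounded_below_J_sub_smul (t δ : ℝ) (hδ : 0 ≤ δ)
    (h : ∀ k x, δ ≤ |S.eigenvalue k x - t|) {u : SeqSpace (SeqSpace ℂ)} (hu : u ∈ finiteSupport) :
    δ * ‖u‖ ≤ ‖S.J u - (t : ℂ) • u‖ := by
  refine le_of_sq_le_sq ?_ (norm_nonneg _)
  -- A single grid on which Plancherel holds for both `u` and `(J - t)u`; the two norms are then
  -- compared grid point by grid point.
  obtain ⟨N, hN0, hN, hN'⟩ := ((Filter.eventually_gt_atTop 0).and
    ((eventually_norm_sq_eq_sum_floquetTransform (p₁ := p₁) (p₂ := p₂) hu).and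
      (eventually_norm_sq_eq_sum_floquetTransform (p₁ := p₁) (p₂ := p₂)
        (S.J_sub_smul_mem_finiteSupport t hu)))).exists
  have hN2 : (0 : ℝ) < (N : ℝ) ^ 2 := by positivity
  refine le_of_mul_le_mul_left ?_ hN2
  rw [mul_pow, mul_left_comm, hN, hN', Finset.mul_sum]
  refine Finset.sum_le_sum fun j _ => ?_
  have hV := isQuasiPeriodic_floquetTransform (p₁ := p₁) (p₂ := p₂)
    (gridPoint N j.1, gridPoint N j.2) (fun q r => u q r)
  have hw := S.sum_norm_sq_symbol_le t δ hδ (gridPoint N j.1, gridPoint N j.2)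
    (fun k => h k _) (fun i => floquetTransform p₁ p₂ (gridPoint N j.1, gridPoint N j.2)
      (fun q r => u q r) ((i.1 : ℕ) + 1) ((i.2 : ℕ) + 1))
  simp only [S.symbol_mulVec hV, ← S.floquetTransform_J_sub_smul _ _ hu] at hw
  exact hw

theorem mem_spectrum_iff (t : ℝ) : (t : ℂ) ∈ spectrum ℂ S.J ↔ t ∈ ⋃ k, S.band k := by
  constructor
  · contrapose!
    intro ht
    obtain ⟨δ, hδ, hball⟩ := Metric.isOpen_iff.1 S.isClosed_iUnion_band.isOpen_compl t ht
    refine S.notMem_spectrum_J t δ hδ fun u hu =>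
      S.bounded_below_J_sub_smul t δ hδ.le (fun k x => ?_) hu
    by_contra! hlt
    refine hball (Metric.mem_ball.2 hlt) ?_
    rw [iUnion_band_eq]
    exact ⟨k, x, rfl⟩
  · rw [iUnion_band_eq]
    rintro ⟨k, x, rfl⟩
    exact S.eigenvalue_mem_spectrum k x

theorem spectrum_J : spectrum ℂ S.J = (fun t : ℝ => (t : ℂ)) '' ⋃ k, S.band k := by
  ext z
  constructor
  · intro hz
    have hre := im_eq_zero_of_mem_spectrum S.J S.inner_J hz
    rw [hre] at hz
    exact ⟨z.re, (S.mem_spectrum_iff _).1 hz, hre.symm⟩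
  · rintro ⟨t, ht, rfl⟩
    exact (S.mem_spectrum_iff t).2 ht

end Coeffs

end JBJ

end

theorem corollary2p3 (p₁ p₂ : ℕ) [NeZero p₁] [NeZero p₂] (S : JBJ.Coeffs p₁ p₂) :
    (∀ k : Fin (p₁ * p₂), BddBelow (S.eigenvalue k '' JBJ.torus) ∧
      BddAbove (S.eigenvalue k '' JBJ.torus)) ∧
    spectrum ℂ S.J = (fun t : ℝ => (t : ℂ)) '' (⋃ k : Fin (p₁ * p₂), S.band k) ∧
    (JBJ.gaps {t : ℝ | (t : ℂ) ∈ spectrum ℂ S.J}).encard ≤ ((p₁ * p₂ - 1 : ℕ) : ℕ∞) := by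
  refine ⟨fun k => ⟨(S.isCompact_image_torus k).bddBelow, (S.isCompact_image_torus k).bddAbove⟩,
    S.spectrum_J, ?_⟩
  have h : {t : ℝ | (t : ℂ) ∈ spectrum ℂ S.J} = ⋃ k, S.band k :=
    Set.ext fun t => S.mem_spectrum_iff t
  rw [h]
  exact S.encard_gaps_iUnion_band_le
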